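/- Let $\mathbb{F}_q$ be a finite field with $q$ elements, $A=\mathbb{F}_q[\theta]$, $K_\infty=\mathbb{F}_q((1/\theta))$, and let $\mathbb{C}_\infty$ be the completion of an algebraic closure of $K_\infty$, with absolute value normalized by $|\theta|_\infty=q$. For $s\ge 1$ let $\mathbb{T}_s$ be the Tate algebra of power series $f=\sum_\nu a_\nu t^\nu\in\mathbb{C}_\infty[[t_1,\dots,t_s]]$ with $|a_\nu|_\infty\to 0$ as $|\nu|\to\infty$, with the Gauss norm $\|f\|_\infty=\sup_\nu|a_\nu|_\infty$; for $n\in\mathbb{Z}$ put $f^{(n)}=\sum_\nu a_\nu^{q^n}t^\nu$, and twist power series in $z$ over $\mathbb{T}_s$, as well as vectors and matrices of such series, coefficientwise and entrywise. View $\mathbb{T}_s$ as an algebra over $A[\underline{t}_s]=A[t_1,\dots,t_s]$ in the natural way. Let $\mathbb{T}_s\{z/\theta\}$ be the ring of power series $\sum_{i\ge 0}a_iz^i\in\mathbb{T}_s[[z]]$ with $q^i\|a_i\|_\infty\to 0$ as $i\to\infty$. Let $\phi$ be a Drinfeld $A[\underline{t}_s]$-module of rank $r\ge 1$ over $\mathbb{T}_s$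 given by $\phi_\theta=\theta+A_1\tau+\cdots+A_r\tau^r$ with $A_1,\dots,A_r\in\mathbb{T}_s$ and $A_r\in\mathbb{T}_s^\times$, where $\tau f=f^{(1)}$ for $f\in\mathbb{T}_s$. Let $\exp_\phi=\sum_{i\ge 0}\alpha_i\tau^i$ be its exponential series, that is, the unique series in $\mathbb{T}_s[[\tau]]$ with $\alpha_0=1$ and $\exp_\phi\theta=\phi_\theta\exp_\phi$; it defines a function $\exp_\phi(f)=\sum_{i\ge0}\alpha_if^{(i)}$ on $\mathbb{T}_s$. Let $\Lambda_\phi=\ker(\exp_\phi)\subseteq\mathbb{T}_s$ be the period lattice, which is an $A[\underline{t}_s]$-submodule of $\mathbb{T}_s$. Put \[ \Phi=\begin{bmatrix} 0 & 1 & \cdots & 0\\ \vdots & \vdots & \ddots & \vdots\\ 0 & 0 & \cdots & 1\\ \dfrac{z-\theta}{A_r^{(-r)}} & -\dfrac{A_1^{(-1)}}{A_r^{(-r)}} & \cdots & -\dfrac{A_{r-1}^{(-r+1)}}{A_r^{(-r)}} \end{bmatrix}\in\mathrm{Mat}_r(\mathbb{T}_s[z]), \] \[ V_\phi=\{\mathbf{g}\in\mathrm{Mat}_{1\times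 r}(\mathbb{T}_s\{z/\theta\})\mid \mathbf{g}^{(-1)}\Phi=\mathbf{g}\}, \] and let $D_0\colon\mathrm{Mat}_{1\times r}(\mathbb{T}_s\{z/\theta\})\to\mathbb{T}_s$ be the map $[g_1,\dots,g_r]\mapsto g_1|_{z=\theta}$. Suppose that $\phi$ has a rigid analytic trivialization, that is, there is a matrix $\Psi\in\mathrm{GL}_r(\mathbb{T}_s\{z/\theta\})$ with $\Psi^{(-1)}=\Phi\Psi$ (an identity of matrices over $\mathbb{T}_s[[z]]$, as is the equation that defines $V_\phi$). Then $D_0$ restricts to a bijection $V_\phi\to\Lambda_\phi$, and $\Lambda_\phi$ is a free $A[\underline{t}_s]$-module of rank $r$. -/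

import Mathlib

namespace TateDrinfeld

noncomputable section

open Filter Topology
open scoped NNReal

/-! Throughout, `Fq` is a finite field with `q = Fintype.card Fq` elements. -/

section

variable (Fq : Type*) [Field Fq] [Fintype Fq]

/-- `K_∞ = 𝔽_q((1/θ))`: Laurent series over `Fq`, whose variable stands for `1/θ`. -/
def KInfty := LaurentSeries Fq

namespace KInfty

instance : Field (KInfty Fq) := inferInstanceAs (Field (LaurentSeries Fq))
instance : Algebra Fq (KInfty Fq) := inferInstanceAs (Algebra Fq (LaurentSeries Fq))
instance : Valued (KInfty Fq) (WithZero (Multiplicative ℤ)) :=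
  inferInstanceAs (Valued (LaurentSeries Fq) (WithZero (Multiplicative ℤ)))
instance : CompleteSpace (KInfty Fq) := inferInstanceAs (CompleteSpace (LaurentSeries Fq))

/-- The element `θ`, the inverse of the Laurent series variable. -/
def theta : KInfty Fq := HahnSeries.single (-1 : ℤ) (1 : Fq)

lemma one_lt_card : (1 : ℝ≥0) < Fintype.card Fq := by
  exact_mod_cast Fintype.one_lt_card

lemma v_theta : Valued.v (theta Fq) = WithZero.exp (1 : ℤ) := by
  have := LaurentSeries.valuation_single_zpow Fq (-1)
  simpa using! this

/-- The `∞`-adic valuation has rank one; the norm is normalized so that `‖θ‖ = q`. -/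
instance : Valuation.RankOne (Valued.v : Valuation (KInfty Fq) (WithZero (Multiplicative ℤ))) where
  hom' := (WithZeroMulInt.toNNReal (one_lt_card Fq).ne_zero).comp
    MonoidWithZeroHom.ValueGroup₀.embedding
  strictMono' := (WithZeroMulInt.toNNReal_strictMono (one_lt_card Fq)).comp
    MonoidWithZeroHom.ValueGroup₀.embedding_strictMono
  exists_val_nontrivial := ⟨theta Fq, by rw [v_theta]; simp, by rw [v_theta]; simp⟩

/-- The `∞`-adic absolute value on `K_∞`. -/
instance : NontriviallyNormedField (KInfty Fq) :=
  Valued.toNontriviallyNormedField (L := KInfty Fq) (Γ₀ := WithZero (Multiplicative ℤ))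
instance : IsUltrametricDist (KInfty Fq) := inferInstance

lemma norm_theta : ‖theta Fq‖ = Fintype.card Fq := by
  change ((WithZeroMulInt.toNNReal (one_lt_card Fq).ne_zero
    (MonoidWithZeroHom.ValueGroup₀.embedding (Valued.v.restrict (theta Fq))) : ℝ≥0) : ℝ) = _
  rw [Valuation.embedding_restrict, v_theta, WithZeroMulInt.toNNReal_neg_apply _ (by simp)]
  simp [WithZero.exp]

end KInfty

/-- An algebraic closure of `K_∞`, with the unique extension of the absolute value. -/
abbrev AlgClosureKInfty := AlgebraicClosure (KInfty Fq)

instance : NormedField (AlgClosureKInfty Fq) :=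
  spectralNorm.normedField (KInfty Fq) (AlgClosureKInfty Fq)

instance : NormedAlgebra (KInfty Fq) (AlgClosureKInfty Fq) := spectralNorm.normedAlgebra _ _

instance : IsUltrametricDist (AlgClosureKInfty Fq) :=
  IsUltrametricDist.isUltrametricDist_of_forall_norm_add_le_max_norm
    (isNonarchimedean_spectralNorm (K := KInfty Fq) (L := AlgClosureKInfty Fq))


/-- `ℂ_∞`, the completion of an algebraic closure of `K_∞`. -/
abbrev CInfty := UniformSpace.Completion (AlgClosureKInfty Fq)

namespace CInfty

instance : Algebra Fq (CInfty Fq) :=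
  ((algebraMap (KInfty Fq) (CInfty Fq)).comp (algebraMap Fq (KInfty Fq))).toAlgebra

instance : IsUltrametricDist (CInfty Fq) := IsUltrametricDist.of_normedAlgebra (KInfty Fq)

/-- The element `θ` of `ℂ_∞`. -/
def theta : CInfty Fq := algebraMap (KInfty Fq) (CInfty Fq) (KInfty.theta Fq)

lemma norm_theta : ‖theta Fq‖ = Fintype.card Fq := by
  rw [theta, norm_algebraMap', KInfty.norm_theta]

lemma frobenius_isUniformInducing :
    IsUniformInducing (FiniteField.frobeniusAlgHom Fq (CInfty Fq)) := by
  have hq : Fintype.card Fq ≠ 0 := Fintype.card_ne_zero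
  rw [Metric.isUniformInducing_iff, Metric.uniformContinuous_iff]
  have key : ∀ x y : CInfty Fq, dist (FiniteField.frobeniusAlgHom Fq (CInfty Fq) x)
      (FiniteField.frobeniusAlgHom Fq (CInfty Fq) y) = dist x y ^ Fintype.card Fq := by
    intro x y
    rw [dist_eq_norm, ← map_sub, FiniteField.frobeniusAlgHom_apply, norm_pow, dist_eq_norm]
  simp only [key]
  refine ⟨fun ε hε => ⟨min ε 1, by positivity, fun {a b} h => ?_⟩, fun δ hδ =>
    ⟨δ ^ Fintype.card Fq, by positivity, fun {a b} h => lt_of_pow_lt_pow_left₀ _ hδ.le h⟩⟩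
  exact (pow_le_of_le_one dist_nonneg (h.le.trans (min_le_right _ _)) hq).trans_lt
    (h.trans_le (min_le_left _ _))

lemma frobenius_bijective :
    Function.Bijective (FiniteField.frobeniusAlgHom Fq (CInfty Fq)) := by
  refine ⟨RingHom.injective (FiniteField.frobeniusAlgHom Fq (CInfty Fq)).toRingHom, ?_⟩
  have hcl : IsClosed (Set.range (FiniteField.frobeniusAlgHom Fq (CInfty Fq))) :=
    (frobenius_isUniformInducing Fq).isComplete_range.isClosed
  have hd : Dense (Set.range (FiniteField.frobeniusAlgHom Fq (CInfty Fq))) := by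
    refine (UniformSpace.Completion.denseRange_coe (α := AlgClosureKInfty Fq)).mono ?_
    rintro _ ⟨a, rfl⟩
    obtain ⟨b, hb⟩ := IsAlgClosed.exists_pow_nat_eq a (n := Fintype.card Fq) Fintype.card_pos
    refine ⟨(b : CInfty Fq), ?_⟩
    rw [FiniteField.frobeniusAlgHom_apply, ← hb]
    exact (map_pow (UniformSpace.Completion.coeRingHom (α := AlgClosureKInfty Fq)) b _).symm
  intro x
  have := hcl.closure_eq ▸ hd x
  exact this

/-- The `q`-power Frobenius automorphism `x ↦ x ^ q` of the perfect field `ℂ_∞`. -/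
def frob : CInfty Fq ≃+* CInfty Fq :=
  RingEquiv.ofBijective (FiniteField.frobeniusAlgHom Fq (CInfty Fq)) (frobenius_bijective Fq)

lemma frob_apply (x : CInfty Fq) : frob Fq x = x ^ Fintype.card Fq := rfl

lemma norm_frob (x : CInfty Fq) : ‖frob Fq x‖ = ‖x‖ ^ Fintype.card Fq := by
  rw [frob_apply, norm_pow]

lemma tendsto_frob {ι : Type*} {l : Filter ι} {a : ι → CInfty Fq} :
    Tendsto (fun i => ‖frob Fq (a i)‖) l (𝓝 0) ↔ Tendsto (fun i => ‖a i‖) l (𝓝 0) := by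
  rw [← tendsto_zero_iff_norm_tendsto_zero, ← tendsto_zero_iff_norm_tendsto_zero]
  have := ((frobenius_isUniformInducing Fq).isInducing.tendsto_nhds_iff (f := a) (l := l) (y := 0))
  rw [map_zero] at this
  exact this.symm

end CInfty


/-- The Tate algebra `𝕋_s` of power series `∑ a_ν t^ν` in `t_1, …, t_s` over `ℂ_∞` with
`‖a_ν‖ → 0` as `|ν| → ∞`. -/
def Tate (s : ℕ) := ↥(MvPowerSeries.IsRestricted.subring (fun _ : Fin s => (1 : ℝ)) :
    Subring (MvPowerSeries (Fin s) (CInfty Fq)))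

namespace Tate
variable (s : ℕ)

instance : CommRing (Tate Fq s) := inferInstanceAs (CommRing
  ↥(MvPowerSeries.IsRestricted.subring (fun _ : Fin s => (1 : ℝ)) :
    Subring (MvPowerSeries (Fin s) (CInfty Fq))))

variable {Fq s}

lemma isRestricted_iff (f : MvPowerSeries (Fin s) (CInfty Fq)) :
    MvPowerSeries.IsRestricted (fun _ : Fin s => (1 : ℝ)) f ↔
      Tendsto (fun ν => ‖MvPowerSeries.coeff ν f‖) cofinite (𝓝 0) := by
  simp [MvPowerSeries.IsRestricted, Finsupp.prod]

/-- The coefficient `a_ν` of `f = ∑ a_ν t^ν`. -/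
def coeff (ν : Fin s →₀ ℕ) (f : Tate Fq s) : CInfty Fq := MvPowerSeries.coeff ν f.1

/-- The element of the Tate algebra given by a power series with coefficients tending to zero. -/
def mk (f : MvPowerSeries (Fin s) (CInfty Fq))
    (hf : Tendsto (fun ν => ‖MvPowerSeries.coeff ν f‖) cofinite (𝓝 0)) : Tate Fq s :=
  ⟨f, (isRestricted_iff f).2 hf⟩

lemma tendsto_coeff (f : Tate Fq s) : Tendsto (fun ν => ‖coeff ν f‖) cofinite (𝓝 0) :=
  (isRestricted_iff f.1).1 f.2

lemma bddAbove (f : Tate Fq s) : BddAbove (Set.range fun ν => ‖coeff ν f‖) := by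
  have h := (tendsto_coeff f).eventually (gt_mem_nhds zero_lt_one)
  rw [Filter.eventually_cofinite] at h
  obtain ⟨M, hM⟩ := (h.image fun ν => ‖coeff ν f‖).bddAbove
  refine ⟨max M 1, ?_⟩
  rintro _ ⟨ν, rfl⟩
  by_cases hν : ‖coeff ν f‖ < 1
  · exact hν.le.trans (le_max_right _ _)
  · exact (hM ⟨ν, hν, rfl⟩).trans (le_max_left _ _)

@[ext] lemma ext {f g : Tate Fq s} (h : ∀ ν, coeff ν f = coeff ν g) : f = g :=
  Subtype.ext (MvPowerSeries.ext h)

/-- The Gauss norm `sup_ν ‖a_ν‖`. -/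
def gauss (f : Tate Fq s) : ℝ := ⨆ ν, ‖coeff ν f‖

lemma coeff_le_gauss (f : Tate Fq s) (ν : Fin s →₀ ℕ) : ‖coeff ν f‖ ≤ gauss f :=
  le_ciSup (bddAbove f) ν

lemma gauss_le {f : Tate Fq s} {B : ℝ} (h : ∀ ν, ‖coeff ν f‖ ≤ B) : gauss f ≤ B := ciSup_le h

lemma gauss_nonneg (f : Tate Fq s) : 0 ≤ gauss f :=
  (norm_nonneg _).trans (coeff_le_gauss f 0)

lemma coeff_zero (ν : Fin s →₀ ℕ) : coeff ν (0 : Tate Fq s) = 0 := rfl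
lemma coeff_add (ν : Fin s →₀ ℕ) (f g : Tate Fq s) :
    coeff ν (f + g) = coeff ν f + coeff ν g := rfl
lemma coeff_sub (ν : Fin s →₀ ℕ) (f g : Tate Fq s) :
    coeff ν (f - g) = coeff ν f - coeff ν g := rfl
lemma coeff_neg (ν : Fin s →₀ ℕ) (f : Tate Fq s) : coeff ν (-f) = -coeff ν f := rfl
lemma coeff_mul (ν : Fin s →₀ ℕ) (f g : Tate Fq s) :
    coeff ν (f * g) = ∑ p ∈ Finset.HasAntidiagonal.antidiagonal ν, coeff p.1 f * coeff p.2 g := by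
  classical
  exact MvPowerSeries.coeff_mul ..

lemma gauss_add_le_max (f g : Tate Fq s) : gauss (f + g) ≤ max (gauss f) (gauss g) :=
  gauss_le fun ν => (IsUltrametricDist.norm_add_le_max _ _).trans
    (max_le_max (coeff_le_gauss f ν) (coeff_le_gauss g ν))

lemma gauss_mul_le (f g : Tate Fq s) : gauss (f * g) ≤ gauss f * gauss g := by
  refine gauss_le fun ν => ?_
  rw [coeff_mul]
  refine IsUltrametricDist.norm_sum_le_of_forall_le_of_nonneg
    (mul_nonneg (gauss_nonneg f) (gauss_nonneg g)) fun p _ => ?_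
  rw [norm_mul]
  exact mul_le_mul (coeff_le_gauss f _) (coeff_le_gauss g _) (norm_nonneg _) (gauss_nonneg f)

/-- The Gauss norm as a ring norm. -/
def gaussRingNorm : RingNorm (Tate Fq s) where
  toFun := gauss
  map_zero' := by simp [gauss, coeff_zero]
  add_le' f g := (gauss_add_le_max f g).trans
    (max_le_add_of_nonneg (gauss_nonneg f) (gauss_nonneg g))
  neg' f := by simp [gauss, coeff_neg]
  mul_le' := gauss_mul_le
  eq_zero_of_map_eq_zero' f hf := ext fun ν =>
    norm_le_zero_iff.1 ((coeff_le_gauss f ν).trans hf.le)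

/-- The Tate algebra with its Gauss norm. -/
instance : NormedCommRing (Tate Fq s) :=
  { (inferInstance : CommRing (Tate Fq s)),
    (RingNorm.toNormedRing gaussRingNorm : NormedRing (Tate Fq s)).toMetricSpace with
    norm := gauss
    dist_eq := (RingNorm.toNormedRing gaussRingNorm : NormedRing (Tate Fq s)).dist_eq
    norm_mul_le := gauss_mul_le }

lemma norm_def (f : Tate Fq s) : ‖f‖ = ⨆ ν, ‖coeff ν f‖ := rfl
lemma coeff_le_norm (f : Tate Fq s) (ν : Fin s →₀ ℕ) : ‖coeff ν f‖ ≤ ‖f‖ := coeff_le_gauss f ν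
lemma norm_le {f : Tate Fq s} {B : ℝ} (h : ∀ ν, ‖coeff ν f‖ ≤ B) : ‖f‖ ≤ B := ciSup_le h

instance : IsUltrametricDist (Tate Fq s) :=
  IsUltrametricDist.isUltrametricDist_of_forall_norm_add_le_max_norm gauss_add_le_max

instance : CompleteSpace (Tate Fq s) := by
  refine Metric.complete_of_cauchySeq_tendsto fun u hu => ?_
  have hc : ∀ ν, CauchySeq fun n => coeff ν (u n) := fun ν => by
    rw [Metric.cauchySeq_iff] at hu ⊢
    intro ε hε
    obtain ⟨N, hN⟩ := hu ε hε
    refine ⟨N, fun m hm n hn => lt_of_le_of_lt ?_ (hN m hm n hn)⟩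
    rw [dist_eq_norm, dist_eq_norm, ← coeff_sub]
    exact coeff_le_norm _ _
  choose a ha using fun ν => cauchySeq_tendsto_of_complete (hc ν)
  have hun : ∀ ε > 0, ∃ N, ∀ n ≥ N, ∀ ν, ‖coeff ν (u n) - a ν‖ ≤ ε := by
    intro ε hε
    obtain ⟨N, hN⟩ := Metric.cauchySeq_iff.1 hu ε hε
    refine ⟨N, fun n hn ν => ?_⟩
    refine le_of_tendsto ((tendsto_const_nhds.sub (ha ν)).norm) ?_
    filter_upwards [eventually_ge_atTop N] with m hm
    have := (hN n hn m hm).le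
    rw [dist_eq_norm] at this
    exact (coeff_le_norm (u n - u m) ν).trans this
  have hr : Tendsto (fun ν => ‖a ν‖) cofinite (𝓝 0) := by
    rw [Metric.tendsto_nhds]
    intro ε hε
    obtain ⟨N, hN⟩ := hun (ε / 2) (by positivity)
    filter_upwards [(tendsto_coeff (u N)).eventually (gt_mem_nhds (half_pos hε))] with ν hν
    have h1 := hN N le_rfl ν
    have h2 : ‖a ν‖ ≤ ‖coeff ν (u N)‖ + ‖coeff ν (u N) - a ν‖ := by
      have := norm_sub_le (coeff ν (u N)) (coeff ν (u N) - a ν)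
      simpa using this
    simp only [Real.dist_eq, sub_zero, abs_norm]
    linarith
  refine ⟨mk a hr, ?_⟩
  rw [Metric.tendsto_atTop]
  intro ε hε
  obtain ⟨N, hN⟩ := hun (ε / 2) (by positivity)
  refine ⟨N, fun n hn => ?_⟩
  rw [dist_eq_norm]
  exact (norm_le fun ν => hN n hn ν).trans_lt (half_lt_self hε)

/-- The twisting automorphism `τ (∑ a_ν t^ν) = ∑ a_ν ^ q t^ν`. -/
def tau : Tate Fq s ≃+* Tate Fq s where
  toFun f := mk (MvPowerSeries.map (CInfty.frob Fq).toRingHom f.1) <| by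
    simpa using! (CInfty.tendsto_frob Fq).2 (tendsto_coeff f)
  invFun f := mk (MvPowerSeries.map (CInfty.frob Fq).symm.toRingHom f.1) <| by
    refine (CInfty.tendsto_frob Fq).1 ?_
    simpa using! tendsto_coeff f
  left_inv f := ext fun ν => by simp [coeff, mk]
  right_inv f := ext fun ν => by simp [coeff, mk]
  map_mul' f g := Subtype.ext (map_mul (MvPowerSeries.map (CInfty.frob Fq).toRingHom) f.1 g.1)
  map_add' f g := Subtype.ext (map_add (MvPowerSeries.map (CInfty.frob Fq).toRingHom) f.1 g.1)

lemma coeff_tau (ν : Fin s →₀ ℕ) (f : Tate Fq s) :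
    coeff ν (tau f) = coeff ν f ^ Fintype.card Fq := rfl

/-- The `n`-fold twist `f^{(n)} = τ^n f`, for `n ∈ ℤ`. -/
def twist (n : ℤ) : Tate Fq s ≃+* Tate Fq s :=
  ((tau : RingAut (Tate Fq s)) ^ n : RingAut (Tate Fq s))

lemma coeff_twist (n : ℕ) (ν : Fin s →₀ ℕ) (f : Tate Fq s) :
    coeff ν (twist n f) = coeff ν f ^ (Fintype.card Fq ^ n) := by
  induction n with
  | zero => simp [twist]
  | succ n ih =>
    have : twist ((n + 1 : ℕ) : ℤ) f = tau (twist n f) := by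
      simp only [twist, zpow_natCast, pow_succ']; rfl
    rw [this, coeff_tau, ih, ← pow_mul, pow_succ]

lemma twist_twist (m n : ℤ) (f : Tate Fq s) : twist m (twist n f) = twist (m + n) f := by
  simp only [twist, zpow_add]; rfl

lemma norm_twist_le (n : ℕ) (f : Tate Fq s) : ‖twist n f‖ ≤ ‖f‖ ^ (Fintype.card Fq ^ n) :=
  norm_le fun ν => by
    rw [coeff_twist, norm_pow]
    exact pow_le_pow_left₀ (norm_nonneg _) (coeff_le_norm f ν) _

lemma continuous_twist (n : ℕ) : Continuous (twist (Fq := Fq) (s := s) n) := by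
  refine continuous_of_continuousAt_zero (twist (Fq := Fq) (s := s) n) ?_
  rw [ContinuousAt, map_zero]
  refine squeeze_zero_norm (norm_twist_le n) ?_
  have h : Continuous fun f : Tate Fq s => ‖f‖ ^ (Fintype.card Fq ^ n) := by fun_prop
  simpa using h.tendsto 0

variable (Fq s) in
/-- Constants. -/
def C : CInfty Fq →+* Tate Fq s :=
  (MvPowerSeries.C).codRestrict _ fun a => MvPowerSeries.isRestricted_C _ a

variable (Fq s) in
/-- The constant `θ` of the Tate algebra. -/
def theta : Tate Fq s := C Fq s (CInfty.theta Fq)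

/-- The variable `t_i`. -/
def X (i : Fin s) : Tate Fq s :=
  ⟨MvPowerSeries.X i, MvPowerSeries.isRestricted_monomial _ _ _⟩

lemma coeff_C (ν : Fin s →₀ ℕ) (a : CInfty Fq) : coeff ν (C Fq s a) = if ν = 0 then a else 0 := by
  classical
  exact MvPowerSeries.coeff_C ν a

lemma coeff_X (ν : Fin s →₀ ℕ) (i : Fin s) :
    coeff ν (X i : Tate Fq s) = if ν = Finsupp.single i 1 then 1 else 0 := by
  classical
  exact MvPowerSeries.coeff_X ν i

lemma norm_C (a : CInfty Fq) : ‖C Fq s a‖ = ‖a‖ := by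
  refine le_antisymm (norm_le fun ν => ?_) ?_
  · rw [coeff_C]; split_ifs <;> simp
  · simpa [coeff_C] using coeff_le_norm (C Fq s a) 0

lemma norm_theta : ‖theta Fq s‖ = Fintype.card Fq := by
  rw [theta, norm_C, CInfty.norm_theta]

lemma twist_C (n : ℕ) (a : CInfty Fq) :
    twist n (C Fq s a) = C Fq s (a ^ (Fintype.card Fq ^ n)) := by
  ext ν
  rw [coeff_twist, coeff_C, coeff_C]
  split_ifs <;> simp

lemma twist_X (n : ℕ) (i : Fin s) : twist n (X i : Tate Fq s) = X i := by
  ext ν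
  rw [coeff_twist, coeff_X]
  split_ifs <;> simp

variable (Fq s) in
/-- The natural map `A[t_s] = 𝔽_q[θ][t_1, …, t_s] → 𝕋_s`, where the polynomial variable of
`Polynomial Fq` goes to `θ`. -/
def ofPoly : MvPolynomial (Fin s) (Polynomial Fq) →+* Tate Fq s :=
  MvPolynomial.eval₂Hom ((C Fq s).comp (Polynomial.aeval (CInfty.theta Fq)).toRingHom) X

/-- `𝕋_s` as an `A[t_s]`-algebra. -/
instance : Algebra (MvPolynomial (Fin s) (Polynomial Fq)) (Tate Fq s) := (ofPoly Fq s).toAlgebra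

lemma norm_theta_pow_sub (n : ℕ) :
    ‖CInfty.theta Fq ^ (Fintype.card Fq ^ (n + 1)) - CInfty.theta Fq‖ =
      (Fintype.card Fq : ℝ) ^ (Fintype.card Fq ^ (n + 1)) := by
  have h1 : (1 : ℝ) < Fintype.card Fq := by exact_mod_cast Fintype.one_lt_card
  have h2 : ‖CInfty.theta Fq‖ < ‖CInfty.theta Fq ^ (Fintype.card Fq ^ (n + 1))‖ := by
    rw [norm_pow, CInfty.norm_theta]
    refine lt_self_pow₀ h1 ?_
    exact Nat.one_lt_pow (by omega) Fintype.one_lt_card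
  rw [sub_eq_add_neg, IsUltrametricDist.norm_add_eq_max_of_norm_ne_norm
    (by rw [norm_neg]; exact h2.ne'), norm_neg, max_eq_left h2.le, norm_pow, CInfty.norm_theta]

end Tate


/-- A Drinfeld `A[t_s]`-module of rank `r ≥ 1` over `𝕋_s` whose leading coefficient is a unit:
`φ_θ = θ + A_1 τ + ⋯ + A_r τ^r` with `A_r ∈ 𝕋_s^×`. It is given by the tuple `(A_1, …, A_r)`, on
which there is no further condition; `coeff k` is `A_{k+1}`. -/
structure DrinfeldModule (s r : ℕ) where
  coeff : Fin r → Tate Fq s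
  rank_pos : 0 < r
  isUnit_leading : IsUnit (coeff ⟨r - 1, Nat.sub_lt rank_pos one_pos⟩)

namespace DrinfeldModule
variable {Fq} {s r : ℕ} (φ : DrinfeldModule Fq s r)

/-- The operator `φ_θ f = θ f + A_1 f^{(1)} + ⋯ + A_r f^{(r)}` on `𝕋_s`. -/
def phiTheta (f : Tate Fq s) : Tate Fq s :=
  Tate.theta Fq s * f + ∑ k : Fin r, φ.coeff k * Tate.twist ((k : ℤ) + 1) f

/-- The coefficients `α_n` of the exponential series `exp_φ = ∑ α_n τ^n` of `φ`: the recursion is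
the one that `α_0 = 1` and `exp_φ θ = φ_θ exp_φ` impose, see `expCoeff_functional`. -/
def expCoeff : ℕ → Tate Fq s
  | 0 => 1
  | n + 1 => Tate.C Fq s ((CInfty.theta Fq ^ (Fintype.card Fq ^ (n + 1)) - CInfty.theta Fq)⁻¹) *
      ∑ k : Fin r, if (k : ℕ) ≤ n then
        φ.coeff k * Tate.twist ((k : ℤ) + 1) (expCoeff (n - k)) else 0
  decreasing_by omega

lemma expCoeff_zero : φ.expCoeff 0 = 1 := by rw [expCoeff]

/-- The coefficient of `τ^n` in `exp_φ θ = φ_θ exp_φ`. -/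
lemma expCoeff_functional (n : ℕ) :
    φ.expCoeff n * Tate.twist n (Tate.theta Fq s) = Tate.theta Fq s * φ.expCoeff n +
      ∑ k : Fin r, if (k : ℕ) + 1 ≤ n then
        φ.coeff k * Tate.twist ((k : ℤ) + 1) (φ.expCoeff (n - (k + 1))) else 0 := by
  cases n with
  | zero => simp [expCoeff_zero, Tate.twist]
  | succ n =>
    have h0 : CInfty.theta Fq ^ (Fintype.card Fq ^ (n + 1)) - CInfty.theta Fq ≠ 0 := by
      rw [← norm_ne_zero_iff, Tate.norm_theta_pow_sub]
      have : (0 : ℝ) < Fintype.card Fq := by exact_mod_cast Fintype.card_pos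
      positivity
    have h1 : Tate.twist ((n + 1 : ℕ) : ℤ) (Tate.theta Fq s) = Tate.theta Fq s +
        Tate.C Fq s (CInfty.theta Fq ^ (Fintype.card Fq ^ (n + 1)) - CInfty.theta Fq) := by
      rw [Tate.theta, Tate.twist_C, map_sub, add_sub_cancel]
    have h2 : Tate.C Fq s (CInfty.theta Fq ^ (Fintype.card Fq ^ (n + 1)) - CInfty.theta Fq) *
        Tate.C Fq s ((CInfty.theta Fq ^ (Fintype.card Fq ^ (n + 1)) - CInfty.theta Fq)⁻¹) = 1 := by
      rw [← map_mul, mul_inv_cancel₀ h0, map_one]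
    simp only [Nat.add_le_add_iff_right, Nat.add_sub_add_right]
    rw [h1, mul_add, mul_comm (φ.expCoeff (n + 1)), add_right_inj, mul_comm]
    conv_lhs => rw [expCoeff]
    rw [← mul_assoc, h2, one_mul]

lemma exists_norm_expCoeff_le : ∃ M ρ : ℝ, 0 ≤ M ∧ 0 < ρ ∧ ρ < 1 ∧
    ∀ n, ‖φ.expCoeff n‖ ≤ (M * ρ ^ n) ^ (Fintype.card Fq ^ n) := by
  set q := Fintype.card Fq with hq
  have hq1 : 1 < q := Fintype.one_lt_card
  have hqR : (1 : ℝ) < q := by exact_mod_cast hq1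
  have hr : (r : ℝ) ≠ 0 := by exact_mod_cast φ.rank_pos.ne'
  obtain ⟨B, hB⟩ := (Set.finite_range fun k : Fin r => ‖φ.coeff k‖).bddAbove
  set M := max B 1
  have hM1 : 1 ≤ M := le_max_right _ _
  have hMk : ∀ k, ‖φ.coeff k‖ ≤ M := fun k => (hB ⟨k, rfl⟩).trans (le_max_left _ _)
  set ρ : ℝ := ((q : ℝ)⁻¹) ^ ((r : ℝ)⁻¹) with hρ
  have hρ0 : 0 < ρ := Real.rpow_pos_of_pos (by positivity) _
  have hρ1 : ρ < 1 := Real.rpow_lt_one (by positivity) (inv_lt_one_of_one_lt₀ hqR) (by positivity)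
  have hρr : ρ ^ r = (q : ℝ)⁻¹ := Real.rpow_inv_natCast_pow (by positivity) φ.rank_pos.ne'
  have main : ∀ n, ‖φ.expCoeff n‖ ≤ M ^ (q ^ n - 1) * (ρ ^ n) ^ (q ^ n) := by
    intro n
    induction n using Nat.strong_induction_on with
    | _ n ih =>
      cases n with
      | zero =>
        rw [expCoeff_zero, ← map_one (Tate.C Fq s), Tate.norm_C]
        simp
      | succ n =>
        rw [expCoeff]
        refine (norm_mul_le _ _).trans ?_
        rw [Tate.norm_C, norm_inv, Tate.norm_theta_pow_sub, ← hq, inv_mul_le_iff₀ (by positivity)]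
        refine IsUltrametricDist.norm_sum_le_of_forall_le_of_nonneg (by positivity) fun k _ => ?_
        split_ifs with hk
        swap
        · rw [norm_zero]; positivity
        have hk' : n - k < n + 1 := by omega
        have e1 : q ^ (n - k) * q ^ ((k : ℕ) + 1) = q ^ (n + 1) := by
          rw [← pow_add]; congr 1; omega
        have hqk : 2 ≤ q ^ ((k : ℕ) + 1) := Nat.one_lt_pow (by omega) hq1
        have hle : q ^ ((k : ℕ) + 1) ≤ q ^ (n + 1) := Nat.pow_le_pow_right (by omega) (by omega)
        have tw : ‖Tate.twist ((k : ℤ) + 1) (φ.expCoeff (n - k))‖ ≤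
            ‖φ.expCoeff (n - k)‖ ^ (q ^ ((k : ℕ) + 1)) := by
          exact_mod_cast Tate.norm_twist_le ((k : ℕ) + 1) (φ.expCoeff (n - k))
        calc ‖φ.coeff k * Tate.twist ((k : ℤ) + 1) (φ.expCoeff (n - k))‖
            ≤ M * (M ^ (q ^ (n - k) - 1) * (ρ ^ (n - k)) ^ (q ^ (n - k))) ^ (q ^ ((k : ℕ) + 1)) := by
              refine (norm_mul_le _ _).trans (mul_le_mul (hMk k) (tw.trans ?_) (norm_nonneg _)
                (by positivity))
              exact pow_le_pow_left₀ (norm_nonneg _) (ih _ hk') _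
          _ = M ^ (1 + (q ^ (n + 1) - q ^ ((k : ℕ) + 1))) * (ρ ^ (n - k)) ^ (q ^ (n + 1)) := by
              rw [mul_pow, ← pow_mul, ← pow_mul (ρ ^ (n - (k : ℕ))), e1, Nat.sub_mul, one_mul, e1,
                ← mul_assoc, ← pow_succ', add_comm 1]
          _ ≤ M ^ (q ^ (n + 1) - 1) * ((q : ℝ) * ρ ^ (n + 1)) ^ (q ^ (n + 1)) := by
              refine mul_le_mul (pow_le_pow_right₀ hM1 (by omega)) ?_ (by positivity)
                (by positivity)
              refine pow_le_pow_left₀ (by positivity) ?_ _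
              have h3 : ρ ^ (n + 1) = ρ ^ (n - (k : ℕ)) * ρ ^ ((k : ℕ) + 1) := by
                rw [← pow_add]; congr 1; omega
              have h4 : (q : ℝ)⁻¹ ≤ ρ ^ ((k : ℕ) + 1) := by
                rw [← hρr]
                exact pow_le_pow_of_le_one hρ0.le hρ1.le (by have := k.2; omega)
              have h5 : 1 ≤ (q : ℝ) * ρ ^ ((k : ℕ) + 1) := by
                rw [inv_le_iff_one_le_mul₀ (by positivity)] at h4
                linarith
              rw [h3, mul_left_comm]
              exact le_mul_of_one_le_right (by positivity) h5
          _ = _ := by rw [mul_pow]; ring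
  refine ⟨M, ρ, by positivity, hρ0, hρ1, fun n => (main n).trans ?_⟩
  rw [mul_pow]
  exact mul_le_mul_of_nonneg_right (pow_le_pow_right₀ hM1 (Nat.sub_le _ _)) (by positivity)

/-- The exponential series is an entire operator: it converges at every `f ∈ 𝕋_s`. -/
lemma summable_exp (f : Tate Fq s) :
    Summable fun n : ℕ => φ.expCoeff n * Tate.twist n f := by
  refine NonarchimedeanAddGroup.summable_of_tendsto_cofinite_zero ?_
  rw [Nat.cofinite_eq_atTop]
  obtain ⟨M, ρ, hM, hρ0, hρ1, h⟩ := φ.exists_norm_expCoeff_le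
  have ht : Tendsto (fun n : ℕ => M * ρ ^ n * ‖f‖) atTop (𝓝 0) := by
    simpa using ((tendsto_pow_atTop_nhds_zero_of_lt_one hρ0.le hρ1).const_mul M).mul_const ‖f‖
  refine squeeze_zero_norm' ?_ ht
  filter_upwards [ht.eventually (ge_mem_nhds zero_lt_one)] with n hn
  calc ‖φ.expCoeff n * Tate.twist n f‖
      ≤ (M * ρ ^ n) ^ (Fintype.card Fq ^ n) * ‖f‖ ^ (Fintype.card Fq ^ n) :=
        (norm_mul_le _ _).trans (mul_le_mul (h n) (Tate.norm_twist_le n f) (norm_nonneg _)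
          (by positivity))
    _ = (M * ρ ^ n * ‖f‖) ^ (Fintype.card Fq ^ n) := by rw [← mul_pow]
    _ ≤ M * ρ ^ n * ‖f‖ := pow_le_of_le_one (by positivity) hn
        (pow_pos Fintype.card_pos n).ne'

/-- The exponential function `exp_φ f = ∑ α_n f^{(n)}` on `𝕋_s`. -/
def exp (f : Tate Fq s) : Tate Fq s := ∑' n : ℕ, φ.expCoeff n * Tate.twist n f

lemma exp_zero : φ.exp 0 = 0 := by simp [exp]

lemma exp_add (f g : Tate Fq s) : φ.exp (f + g) = φ.exp f + φ.exp g := by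
  simp only [exp, map_add, mul_add]
  exact (φ.summable_exp f).tsum_add (φ.summable_exp g)

lemma exp_mul_of_fixed {a : Tate Fq s} (ha : ∀ n : ℕ, Tate.twist n a = a) (f : Tate Fq s) :
    φ.exp (a * f) = a * φ.exp f := by
  simp only [exp, map_mul, ha]
  rw [← (φ.summable_exp f).tsum_mul_left]
  exact tsum_congr fun n => by ring

lemma exp_theta_mul (f : Tate Fq s) :
    φ.exp (Tate.theta Fq s * f) = φ.phiTheta (φ.exp f) := by
  have h0 := (φ.summable_exp f).hasSum
  have hk : ∀ k : Fin r, HasSum (fun n : ℕ => if (k : ℕ) + 1 ≤ n then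
      φ.coeff k * Tate.twist ((k : ℤ) + 1) (φ.expCoeff (n - (k + 1))) * Tate.twist n f else 0)
      (φ.coeff k * Tate.twist ((k : ℤ) + 1) (φ.exp f)) := by
    intro k
    have h1 := ((h0.map (Tate.twist (Fq := Fq) (s := s) (((k : ℕ) + 1 : ℕ) : ℤ))
      (Tate.continuous_twist _)).mul_left (φ.coeff k))
    rw [← hasSum_nat_add_iff' ((k : ℕ) + 1), Finset.sum_eq_zero, sub_zero]
    · refine Eq.mpr (congrArg (fun g => HasSum g _) (funext fun n => ?_)) h1
      rw [if_pos (by omega), Function.comp, map_mul, Tate.twist_twist, Nat.add_sub_cancel,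
        ← mul_assoc]
      push_cast
      rw [add_comm (n : ℤ)]
    · intro n hn
      rw [Finset.mem_range] at hn
      rw [if_neg (by omega)]
  have hs := (h0.mul_left (Tate.theta Fq s)).add (hasSum_sum fun k (_ : k ∈ Finset.univ) => hk k)
  rw [phiTheta, ← exp] at *
  refine Eq.trans (tsum_congr fun n => ?_) hs.tsum_eq
  rw [map_mul, ← mul_assoc, φ.expCoeff_functional, add_mul, mul_assoc, Finset.sum_mul]
  simp only [ite_mul, zero_mul]

lemma exp_C_mul (c : Fq) (f : Tate Fq s) :
    φ.exp (Tate.C Fq s (algebraMap Fq _ c) * f) = Tate.C Fq s (algebraMap Fq _ c) * φ.exp f :=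
  φ.exp_mul_of_fixed (fun n => by
    rw [Tate.twist_C, ← map_pow, FiniteField.pow_card_pow]) f

/-- The period lattice `Λ_φ = ker exp_φ`, an `A[t_s]`-submodule of `𝕋_s`. -/
def periodLattice : Submodule (MvPolynomial (Fin s) (Polynomial Fq)) (Tate Fq s) where
  carrier := {l | φ.exp l = 0}
  zero_mem' := φ.exp_zero
  add_mem' {a b} ha hb := by
    rw [Set.mem_ofPred_eq] at *
    rw [exp_add, ha, hb, add_zero]
  smul_mem' a l hl := by
    rw [Set.mem_ofPred_eq] at *
    have hθ : ∀ f, φ.exp f = 0 → φ.exp (Tate.theta Fq s * f) = 0 := fun f hf => by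
      rw [exp_theta_mul, hf]; simp [phiTheta]
    change φ.exp (Tate.ofPoly Fq s a * l) = 0
    induction a using MvPolynomial.induction_on generalizing l with
    | C p =>
      have e : Tate.ofPoly Fq s (MvPolynomial.C p) =
          Tate.C Fq s (Polynomial.aeval (CInfty.theta Fq) p) := by simp [Tate.ofPoly]
      rw [e]
      induction p using Polynomial.induction_on' with
      | add p₁ p₂ h₁ h₂ =>
        rw [map_add, map_add, add_mul, exp_add, h₁ (by simp [Tate.ofPoly]),
          h₂ (by simp [Tate.ofPoly]), add_zero]
      | monomial n c =>
        rw [Polynomial.aeval_monomial, map_mul, map_pow, mul_assoc, exp_C_mul]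
        refine mul_eq_zero_of_right _ ?_
        clear e
        change φ.exp (Tate.theta Fq s ^ n * l) = 0
        induction n with
        | zero => simpa using hl
        | succ n ih => rw [pow_succ', mul_assoc]; exact hθ _ ih
    | add p₁ p₂ h₁ h₂ => rw [map_add, add_mul, exp_add, h₁ l hl, h₂ l hl, add_zero]
    | mul_X p i h =>
      rw [map_mul, mul_assoc]
      refine h _ ?_
      have e : Tate.ofPoly Fq s (MvPolynomial.X i) = Tate.X i := by simp [Tate.ofPoly]
      rw [e, φ.exp_mul_of_fixed (fun n => Tate.twist_X n i), hl, mul_zero]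

end DrinfeldModule

/-- For `c ∈ 𝕋_s`, the ring `𝕋_s{z/c}` of power series `∑ a_i z^i` over `𝕋_s` with
`‖c‖^i ‖a_i‖ → 0` as `i → ∞`. -/
def TateDisc {Fq : Type*} [Field Fq] [Fintype Fq] {s : ℕ} (c : Tate Fq s) :
    Subring (PowerSeries (Tate Fq s)) :=
  PowerSeries.IsRestricted.subring ‖c‖

namespace TateDisc
variable {Fq} {s : ℕ}

lemma mem_iff (c : Tate Fq s) (f : PowerSeries (Tate Fq s)) : f ∈ TateDisc c ↔
    Tendsto (fun i : ℕ => ‖PowerSeries.coeff i f‖ * ‖c‖ ^ i) atTop (𝓝 0) :=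
  PowerSeries.isRestricted_iff' ‖c‖ f

lemma summable_eval (c : Tate Fq s) (f : TateDisc c) :
    Summable fun i : ℕ => PowerSeries.coeff i f.1 * c ^ i := by
  refine NonarchimedeanAddGroup.summable_of_tendsto_cofinite_zero ?_
  rw [Nat.cofinite_eq_atTop]
  refine squeeze_zero_norm' ?_ ((mem_iff c f.1).1 f.2)
  filter_upwards [eventually_gt_atTop 0] with i hi
  exact (norm_mul_le _ _).trans
    (mul_le_mul_of_nonneg_left (norm_pow_le' c hi) (norm_nonneg _))

/-- Evaluation `f ↦ f|_{z = c}`; the series converges. -/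
def eval (c : Tate Fq s) (f : TateDisc c) : Tate Fq s :=
  ∑' i : ℕ, PowerSeries.coeff i f.1 * c ^ i

end TateDisc

namespace DrinfeldModule
variable {Fq} {s r : ℕ} (φ : DrinfeldModule Fq s r)

/-- The leading coefficient `A_r` as a unit of `𝕋_s`. -/
def leadingUnit : (Tate Fq s)ˣ := φ.isUnit_leading.unit

/-- The matrix `Φ` over `𝕋_s[z]` that represents multiplication by `σ = τ⁻¹` on the Frobenius
module `𝕋_s[σ]` in the `𝕋_s[z]`-basis `1, σ, …, σ^{r-1}`. Its first `r - 1` rows are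
`e_2, …, e_r` and its last row is
`[(z - θ) / A_r^{(-r)}, -A_1^{(-1)} / A_r^{(-r)}, …, -A_{r-1}^{(-(r-1))} / A_r^{(-r)}]`. -/
def Phi : Matrix (Fin r) (Fin r) (Polynomial (Tate Fq s)) := fun i j =>
  if (i : ℕ) + 1 < r then (if (j : ℕ) = i + 1 then 1 else 0)
  else if (j : ℕ) = 0 then
    Polynomial.C (Tate.twist (-(r : ℤ)) ↑φ.leadingUnit⁻¹) *
      (Polynomial.X - Polynomial.C (Tate.theta Fq s))
  else
    -Polynomial.C (Tate.twist (-(r : ℤ)) ↑φ.leadingUnit⁻¹ *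
      Tate.twist (-(j : ℤ)) (φ.coeff ⟨(j : ℕ) - 1, by omega⟩))

/-- `Φ` as a matrix over `𝕋_s[[z]]`. -/
def PhiSeries : Matrix (Fin r) (Fin r) (PowerSeries (Tate Fq s)) :=
  φ.Phi.map Polynomial.toPowerSeries

/-- The twist `f^{(-1)}` of `f ∈ 𝕋_s[[z]]`, applied to the coefficients of the powers of `z`.
(The ring `𝕋_s{z/θ}` is not stable under it, so that equations between twists are read in
`𝕋_s[[z]]`.) -/
def invTwist (f : PowerSeries (Tate Fq s)) : PowerSeries (Tate Fq s) :=
  PowerSeries.map (Tate.twist (-1) : Tate Fq s ≃+* Tate Fq s).toRingHom f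

/-- `Ψ ∈ GL_r(𝕋_s{z/θ})` gives a rigid analytic trivialization of `φ`: `Ψ^{(-1)} = Φ Ψ`. -/
def IsRigidAnalyticTrivialization (Ψ : Matrix.GeneralLinearGroup (Fin r)
    (TateDisc (Tate.theta Fq s))) : Prop :=
  Ψ.val.map (fun f => invTwist f.1) = φ.PhiSeries * Ψ.val.map (fun f => f.1)

/-- `V_φ`: the row vectors `g` over `𝕋_s{z/θ}` with `g^{(-1)} Φ = g`. -/
def V : Set (Fin r → TateDisc (Tate.theta Fq s)) :=
  {g | Matrix.vecMul (fun j => invTwist (g j).1) φ.PhiSeries = fun j => (g j).1}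

/-- The map `D_0`, `g = [g_1, …, g_r] ↦ g_1|_{z = θ}`, on row vectors over `𝕋_s{z/θ}`. -/
def D0 (g : Fin r → TateDisc (Tate.theta Fq s)) : Tate Fq s :=
  TateDisc.eval (Tate.theta Fq s) (g ⟨0, φ.rank_pos⟩)

end DrinfeldModule

end

end

end TateDrinfeld

open TateDrinfeld

/-!
At `0` the operator `φ_θ` has derivative `θ` and `exp_φ` has derivative `1`, so
`exp_φ (θ f) = φ_θ (exp_φ f)` makes `exp_φ` the linearization of `φ_θ`: a sequence `h` with
`φ_θ (h 0) = 0`, `φ_θ (h (n + 1)) = h n` and `θ ^ (n + 1) * h n → l` must be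
`h n = exp_φ (l / θ ^ (n + 1))`, which is such a sequence exactly when `l` is a period.

For a solution `g` of `g^{(-1)} Φ = g`, the `n`-th coefficient of `g_1 / (θ - z)` gives such a
sequence. It determines all entries of `g`, and the partial sums of `g_1` at `z = θ` are
`θ ^ (n + 1) * h n`, so that its limit `l` is `D_0 g`. A trivialization `Ψ` turns the equation of
`V_φ` into the invariance of `g Ψ` under the twist, which forces the entries of `g Ψ` to be
polynomials over `𝔽_q` in `z, t_1, …, t_s`.
-/

namespace TateDrinfeld

noncomputable section

open Filter Topology Asymptotics

lemma sum_range_coeff_C_sub_X_mul_mul_pow {R : Type*} [CommRing R] (c : R)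
    (f : PowerSeries R) (n : ℕ) :
    ∑ i ∈ Finset.range (n + 1), PowerSeries.coeff i ((PowerSeries.C c - PowerSeries.X) * f) * c ^ i
      = c ^ (n + 1) * PowerSeries.coeff n f := by
  induction n with
  | zero => simp [sub_mul]
  | succ n ih =>
    rw [Finset.sum_range_succ, ih, sub_mul, map_sub, PowerSeries.coeff_C_mul,
      PowerSeries.coeff_succ_X_mul]
    ring

lemma tsum_coeff_mul_mul_pow {R : Type*} [NormedCommRing R] [IsUltrametricDist R]
    [CompleteSpace R] {f g : PowerSeries R} {c : R}
    (hf : Summable fun i : ℕ => PowerSeries.coeff i f * c ^ i)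
    (hg : Summable fun i : ℕ => PowerSeries.coeff i g * c ^ i) :
    ∑' i : ℕ, PowerSeries.coeff i (f * g) * c ^ i =
      (∑' i : ℕ, PowerSeries.coeff i f * c ^ i) * ∑' i : ℕ, PowerSeries.coeff i g * c ^ i := by
  have : NonarchimedeanRing R := ⟨NonarchimedeanAddGroup.is_nonarchimedean⟩
  have hfg := hf.mul_of_nonarchimedean hg
  rw [hf.tsum_mul_tsum_eq_tsum_sum_antidiagonal hg hfg]
  refine tsum_congr fun n => ?_
  rw [PowerSeries.coeff_mul, Finset.sum_mul]
  refine Finset.sum_congr rfl fun p hp => ?_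
  rw [← Finset.HasAntidiagonal.mem_antidiagonal.1 hp, pow_add, mul_mul_mul_comm]

lemma mem_range_algebraMap_iff_pow_card_eq {K L : Type*} [Field K] [Fintype K] [CommRing L]
    [IsDomain L] [Algebra K L] {a : L} :
    a ∈ Set.range (algebraMap K L) ↔ a ^ Fintype.card K = a := by
  constructor
  · rintro ⟨b, rfl⟩
    rw [← map_pow, FiniteField.pow_card]
  · intro ha
    have hsplits : (Polynomial.X ^ Fintype.card K - Polynomial.X : Polynomial K).Splits := by
      rw [Polynomial.splits_iff_card_roots, FiniteField.roots_X_pow_card_sub_X,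
        FiniteField.X_pow_card_sub_X_natDegree_eq _ Fintype.one_lt_card]
      rfl
    refine hsplits.mem_range_of_isRoot
      (FiniteField.X_pow_card_sub_X_ne_zero _ Fintype.one_lt_card) (i := algebraMap K L) ?_
    simp [ha]

lemma one_le_norm_of_pow_eq_self {L : Type*} [NormedDivisionRing L] {a : L} {n : ℕ} (hn : 1 < n)
    (ha : a ^ n = a) (ha₀ : a ≠ 0) : 1 ≤ ‖a‖ := by
  by_contra! h
  have hlt := pow_lt_self_of_lt_one₀ (norm_pos_iff.2 ha₀) h hn
  rw [← norm_pow, ha] at hlt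
  exact hlt.false

lemma exists_mvPolynomial_coeff_coeff_eq {σ R : Type*} [CommSemiring R] {b : ℕ × (σ →₀ ℕ) → R}
    (hb : b.support.Finite) : ∃ p : MvPolynomial σ (Polynomial R),
      ∀ n ν, (p.coeff ν).coeff n = b (n, ν) := by
  classical
  refine ⟨∑ i ∈ hb.toFinset, MvPolynomial.monomial i.2 (Polynomial.monomial i.1 (b i)),
    fun n ν => ?_⟩
  have hcoeff (i : ℕ × (σ →₀ ℕ)) :
      ((MvPolynomial.monomial i.2 (Polynomial.monomial i.1 (b i))).coeff ν).coeff n =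
        if i = (n, ν) then b i else 0 := by
    obtain ⟨m, μ⟩ := i
    rw [MvPolynomial.coeff_monomial, apply_ite (Polynomial.coeff · n), Polynomial.coeff_monomial,
      Polynomial.coeff_zero, ← ite_and]
    simp only [Prod.mk.injEq, and_comm]
  simp only [MvPolynomial.coeff_sum, Polynomial.finsetSum_coeff, hcoeff, Finset.sum_ite_eq',
    Set.Finite.mem_toFinset, Function.mem_support]
  exact ite_eq_left_iff.2 fun h => (not_not.1 h).symm

lemma vecMul_map_eq_iff_of_isUnit {A B n : Type*} [CommRing A] [CommRing B] [Fintype n]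
    [DecidableEq n] {ι T : A →+* B} {P : Matrix n n B} {Ψ : Matrix n n A} (hu : IsUnit Ψ)
    (hΨ : Ψ.map T = P * Ψ.map ι) (g : n → A) :
    Matrix.vecMul (T ∘ g) P = ι ∘ g ↔
      ∀ j, T (Matrix.vecMul g Ψ j) = ι (Matrix.vecMul g Ψ j) := by
  have hinj : Function.Injective fun x => Matrix.vecMul x (Ψ.map ι) :=
    Matrix.vecMul_injective_of_isUnit (hu.map ι.mapMatrix)
  rw [← hinj.eq_iff, Matrix.vecMul_vecMul, ← hΨ, funext_iff]
  simp only [RingHom.map_vecMul, Function.comp_def]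

section Linearization

/-- The sequences `h` with `T (h 0) = 0` and `T (h (n + 1)) = h n`, that is, the coefficient
sequences of the power series `H = ∑ h_n z ^ n` with `T H = z H`. For `T = φ_θ` they are chains of
successive `θ`-division points of `0`. -/
structure IsDivisionTower {E : Type*} [Zero E] (T : E → E) (h : ℕ → E) : Prop where
  apply_zero : T (h 0) = 0
  apply_succ (n : ℕ) : T (h (n + 1)) = h n

variable {𝕜 E : Type*} [NontriviallyNormedField 𝕜] [NormedAddCommGroup E] [NormedSpace 𝕜 E]
  {c : 𝕜} {e : E → E} {h : ℕ → E} {l : E}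

lemma eventually_norm_le_of_hasFDerivAt_smul_id [IsUltrametricDist E] {T : E → E} (hT₀ : T 0 = 0)
    (hT : HasFDerivAt T (c • ContinuousLinearMap.id 𝕜 E) 0) (hc : c ≠ 0) :
    ∀ᶠ x in 𝓝 0, ‖T x‖ ≤ ‖c‖ * ‖x‖ := by
  have hlin : (fun x => T x - c • x) =o[𝓝 0] fun x => x := by simpa [hT₀] using hT.isLittleO
  filter_upwards [hlin.def (norm_pos_iff.2 hc)] with x hx
  calc ‖T x‖ = ‖(T x - c • x) + c • x‖ := by rw [sub_add_cancel]
    _ ≤ max ‖T x - c • x‖ ‖c • x‖ := IsUltrametricDist.norm_add_le_max _ _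
    _ ≤ ‖c‖ * ‖x‖ := max_le hx (norm_smul_le c x)

lemma norm_le_pow_mul_norm_of_backward_orbit {T : E → E} {C ε : ℝ} (hC : 1 ≤ C)
    (hT : ∀ x, ‖x‖ < ε → ‖T x‖ ≤ C * ‖x‖) {y : ℕ → E} (hy : ∀ n, T (y (n + 1)) = y n) (k m : ℕ)
    (hk : C ^ k * ‖y (m + k)‖ < ε) : ‖y m‖ ≤ C ^ k * ‖y (m + k)‖ := by
  induction k with
  | zero => simp
  | succ k ih =>
    have hsmall : ‖y (m + (k + 1))‖ < ε :=
      (le_mul_of_one_le_left (norm_nonneg _) (one_le_pow₀ hC)).trans_lt hk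
    have hstep : C ^ k * ‖y (m + k)‖ ≤ C ^ (k + 1) * ‖y (m + (k + 1))‖ := by
      rw [pow_succ, mul_assoc, ← hy (m + k)]
      exact mul_le_mul_of_nonneg_left (hT _ hsmall) (by positivity)
    exact (ih (hstep.trans_lt hk)).trans hstep

lemma eq_zero_of_backward_orbit [IsUltrametricDist E] {T : E → E} (hT₀ : T 0 = 0)
    (hT : HasFDerivAt T (c • ContinuousLinearMap.id 𝕜 E) 0) (hc : 1 ≤ ‖c‖) {y : ℕ → E}
    (hy : ∀ n, T (y (n + 1)) = y n) (hlim : Tendsto (fun n => c ^ n • y n) atTop (𝓝 0)) :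
    y = 0 := by
  have hc₀ : c ≠ 0 := norm_pos_iff.1 (one_pos.trans_le hc)
  obtain ⟨ε, hε, hball⟩ :=
    Metric.eventually_nhds_iff.1 (eventually_norm_le_of_hasFDerivAt_smul_id hT₀ hT hc₀)
  simp only [dist_zero_right] at hball
  funext m
  have hshift : Tendsto (fun k => ‖c‖ ^ k * ‖y (m + k)‖) atTop (𝓝 0) := by
    have hm := ((hlim.comp (tendsto_add_atTop_nat m)).const_smul (c ^ m)⁻¹).norm
    rw [smul_zero, norm_zero] at hm
    refine hm.congr fun k => ?_
    rw [Function.comp_apply, smul_smul, add_comm k m, pow_add,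
      inv_mul_cancel_left₀ (pow_ne_zero m hc₀), norm_smul, norm_pow]
  refine norm_le_zero_iff.1 (ge_of_tendsto hshift ?_)
  filter_upwards [hshift.eventually (gt_mem_nhds hε)] with k hk
  exact norm_le_pow_mul_norm_of_backward_orbit hc (fun x => @hball x) hy k m hk

lemma tendsto_pow_smul_map_inv_pow_smul (he₀ : e 0 = 0)
    (he : HasFDerivAt e (ContinuousLinearMap.id 𝕜 E) 0) (hc : 1 < ‖c‖) (l : E) :
    Tendsto (fun n => c ^ n • e ((c ^ n)⁻¹ • l)) atTop (𝓝 l) := by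
  have hpow : Tendsto (fun n => ‖c ^ n‖) atTop atTop := by
    simpa only [norm_pow] using tendsto_pow_atTop_atTop_of_one_lt hc
  simpa [he₀] using he.lim l hpow

lemma tendsto_pow_smul_comp_of_hasFDerivAt_zero {F : E → E} (hF₀ : F 0 = 0)
    (hF : HasFDerivAt F (0 : E →L[𝕜] E) 0) (hc : 1 < ‖c‖)
    (hlim : Tendsto (fun n => c ^ (n + 1) • h n) atTop (𝓝 l)) :
    Tendsto (fun n => c ^ n • F (h n)) atTop (𝓝 0) := by
  have hc₀ : c ≠ 0 := norm_pos_iff.1 (one_pos.trans hc)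
  have hsmall : F =o[𝓝 0] fun x => x := by simpa [hF₀] using hF.isLittleO
  have hbdd : (fun n => c ^ n • h n) =O[atTop] fun _ => (1 : ℝ) := by
    refine ((hlim.const_smul c⁻¹).congr fun n => ?_).isBigO_one ℝ
    rw [smul_smul, pow_succ', inv_mul_cancel_left₀ hc₀]
  have hzero : Tendsto h atTop (𝓝 0) := by
    have hinv : Tendsto (fun n => c⁻¹ ^ (n + 1)) atTop (𝓝 0) :=
      (tendsto_pow_atTop_nhds_zero_of_norm_lt_one
        (by rw [norm_inv]; exact inv_lt_one_of_one_lt₀ hc)).comp (tendsto_add_atTop_nat 1)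
    refine (zero_smul 𝕜 l ▸ hinv.smul hlim).congr fun n => ?_
    rw [smul_smul, inv_pow, inv_mul_cancel₀ (pow_ne_zero _ hc₀), one_smul]
  have hcomp : (fun n => c ^ n • F (h n)) =o[atTop] fun n => c ^ n • h n :=
    (isBigO_refl (fun n => c ^ n) atTop).smul_isLittleO (hsmall.comp_tendsto hzero)
  exact (isLittleO_one_iff ℝ).1 (hcomp.trans_isBigO hbdd)

variable {T : E →+ E}

lemma map_inv_pow_smul (hsemi : ∀ x, e (c • x) = T (e x)) (hc : c ≠ 0) (n : ℕ) :
    T (e ((c ^ (n + 1))⁻¹ • l)) = e ((c ^ n)⁻¹ • l) := by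
  rw [← hsemi, smul_smul, pow_succ', mul_inv, mul_inv_cancel_left₀ hc]

lemma IsDivisionTower.eq_map_inv_pow_smul [IsUltrametricDist E] (hh : IsDivisionTower T h)
    (hT : HasFDerivAt T (c • ContinuousLinearMap.id 𝕜 E) 0) (he₀ : e 0 = 0)
    (he : HasFDerivAt e (ContinuousLinearMap.id 𝕜 E) 0) (hsemi : ∀ x, e (c • x) = T (e x))
    (hc : 1 < ‖c‖) (hlim : Tendsto (fun n => c ^ (n + 1) • h n) atTop (𝓝 l)) :
    h = fun n => e ((c ^ (n + 1))⁻¹ • l) := by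
  have hc₀ : c ≠ 0 := norm_pos_iff.1 (one_pos.trans hc)
  refine sub_eq_zero.1 (eq_zero_of_backward_orbit (map_zero T) hT hc.le (fun n => ?_) ?_)
  · rw [Pi.sub_apply, map_sub, hh.apply_succ, map_inv_pow_smul hsemi hc₀, Pi.sub_apply]
  · have hexp := (tendsto_pow_smul_map_inv_pow_smul he₀ he hc l).comp (tendsto_add_atTop_nat 1)
    have hdiff := (hlim.sub hexp).const_smul c⁻¹
    rw [sub_self, smul_zero] at hdiff
    refine hdiff.congr fun n => ?_
    rw [Function.comp_apply, ← smul_sub, smul_smul, pow_succ', inv_mul_cancel_left₀ hc₀,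
      Pi.sub_apply, pow_succ']

lemma isDivisionTower_and_tendsto_iff [IsUltrametricDist E]
    (hT : HasFDerivAt T (c • ContinuousLinearMap.id 𝕜 E) 0) (he₀ : e 0 = 0)
    (he : HasFDerivAt e (ContinuousLinearMap.id 𝕜 E) 0) (hsemi : ∀ x, e (c • x) = T (e x))
    (hc : 1 < ‖c‖) :
    IsDivisionTower T h ∧ Tendsto (fun n => c ^ (n + 1) • h n) atTop (𝓝 l) ↔
      e l = 0 ∧ h = fun n => e ((c ^ (n + 1))⁻¹ • l) := by
  have hc₀ : c ≠ 0 := norm_pos_iff.1 (one_pos.trans hc)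
  have hbase : T (e ((c ^ (0 + 1))⁻¹ • l)) = e l := by
    rw [map_inv_pow_smul hsemi hc₀, pow_zero, inv_one, one_smul]
  constructor
  · rintro ⟨hh, hlim⟩
    have heq := hh.eq_map_inv_pow_smul hT he₀ he hsemi hc hlim
    exact ⟨by rw [← hbase, ← congrFun heq 0, hh.apply_zero], heq⟩
  · rintro ⟨hl, rfl⟩
    exact ⟨⟨hbase.trans hl, fun n => map_inv_pow_smul hsemi hc₀ (n + 1)⟩,
      (tendsto_pow_smul_map_inv_pow_smul he₀ he hc l).comp (tendsto_add_atTop_nat 1)⟩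

end Linearization

lemma KInfty.one_lt_norm_theta {Fq : Type*} [Field Fq] [Fintype Fq] :
    1 < ‖KInfty.theta Fq‖ := by
  rw [norm_theta]
  exact_mod_cast Fintype.one_lt_card

namespace Tate

variable {Fq : Type*} [Field Fq] [Fintype Fq] {s : ℕ}

/-- `𝕋_s` as a normed algebra over `K_∞`, the complete field over which the operators on `𝕋_s`
are differentiated. -/
instance : NormedAlgebra (KInfty Fq) (Tate Fq s) where
  __ := ((C Fq s).comp (algebraMap (KInfty Fq) (CInfty Fq))).toAlgebra
  norm_smul_le a f := by
    refine (norm_mul_le _ _).trans_eq ?_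
    rw [RingHom.comp_apply, norm_C, norm_algebraMap']

lemma theta_smul (f : Tate Fq s) : KInfty.theta Fq • f = theta Fq s * f := rfl

lemma theta_pow_smul (n : ℕ) (f : Tate Fq s) : KInfty.theta Fq ^ n • f = theta Fq s ^ n * f := by
  rw [Algebra.smul_def, map_pow, Algebra.algebraMap_eq_smul_one, theta_smul, mul_one]

lemma hasFDerivAt_twist_zero {m : ℤ} (hm : 0 < m) :
    HasFDerivAt (𝕜 := KInfty Fq) (twist (Fq := Fq) (s := s) m) 0 0 := by
  lift m to ℕ using hm.le
  have hpow : 1 < Fintype.card Fq ^ m :=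
    Nat.one_lt_pow (by exact_mod_cast hm.ne') Fintype.one_lt_card
  refine (IsBigO.of_norm_le fun f => ?_).hasFDerivAt hpow
  simpa using norm_twist_le m f

end Tate

namespace DrinfeldModule

variable {Fq : Type*} [Field Fq] [Fintype Fq] {s r : ℕ} (φ : DrinfeldModule Fq s r)

open Tate

lemma norm_exp_sub_le {M : ℝ} (hM : 0 ≤ M)
    (h : ∀ n, ‖φ.expCoeff n‖ ≤ M ^ (Fintype.card Fq ^ n)) {f : Tate Fq s} (hf : M * ‖f‖ ≤ 1) :
    ‖φ.exp f - f‖ ≤ (M * ‖f‖) ^ 2 := by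
  have htail : φ.exp f - f = ∑' n : ℕ, φ.expCoeff (n + 1) * twist ((n + 1 : ℕ) : ℤ) f := by
    rw [exp, (φ.summable_exp f).tsum_eq_zero_add, expCoeff_zero]
    simp [twist]
  rw [htail]
  refine (IsUltrametricDist.norm_tsum_le _).trans (ciSup_le fun n => ?_)
  calc ‖φ.expCoeff (n + 1) * twist ((n + 1 : ℕ) : ℤ) f‖
      ≤ M ^ (Fintype.card Fq ^ (n + 1)) * ‖f‖ ^ (Fintype.card Fq ^ (n + 1)) :=
        norm_mul_le_of_le (h _) (norm_twist_le _ f)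
    _ = (M * ‖f‖) ^ (Fintype.card Fq ^ (n + 1)) := (mul_pow _ _ _).symm
    _ ≤ (M * ‖f‖) ^ 2 := pow_le_pow_of_le_one (by positivity) hf
        (Nat.one_lt_pow n.succ_ne_zero Fintype.one_lt_card)

lemma hasFDerivAt_exp_zero :
    HasFDerivAt φ.exp (ContinuousLinearMap.id (KInfty Fq) (Tate Fq s)) 0 := by
  obtain ⟨M, ρ, hM, hρ₀, hρ₁, hα⟩ := φ.exists_norm_expCoeff_le
  have hα' (n : ℕ) : ‖φ.expCoeff n‖ ≤ M ^ (Fintype.card Fq ^ n) :=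
    (hα n).trans (pow_le_pow_left₀ (by positivity)
      (mul_le_of_le_one_right hM (pow_le_one₀ hρ₀.le hρ₁.le)) _)
  have hsmall : ∀ᶠ f : Tate Fq s in 𝓝 0, M * ‖f‖ ≤ 1 := by
    have hlim : Tendsto (fun f : Tate Fq s => M * ‖f‖) (𝓝 0) (𝓝 0) := by
      simpa using tendsto_norm_zero.const_mul M
    exact hlim.eventually (ge_mem_nhds one_pos)
  have hquad : (fun f => φ.exp f - f) =O[𝓝 0] fun f => ‖f - 0‖ ^ 2 := by
    refine IsBigO.of_bound (M ^ 2) (hsmall.mono fun f hf => ?_)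
    simpa [mul_pow] using φ.norm_exp_sub_le hM hα' hf
  have hdiff : HasFDerivAt (fun f => φ.exp f - f) (0 : Tate Fq s →L[KInfty Fq] Tate Fq s) 0 :=
    hquad.hasFDerivAt one_lt_two
  simpa using hdiff.fun_add (hasFDerivAt_id (0 : Tate Fq s))

/-- The operator `φ_θ` as an endomorphism of the additive group of `𝕋_s`. -/
def phiThetaHom : Tate Fq s →+ Tate Fq s :=
  AddMonoidHom.mk' φ.phiTheta fun f g => by
    simp only [phiTheta, map_add, mul_add, Finset.sum_add_distrib]
    ring

lemma phiThetaHom_apply (f : Tate Fq s) : φ.phiThetaHom f = φ.phiTheta f := rfl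

/-- The index of the first entry of a row vector of length `r`. -/
def firstIndex : Fin r := ⟨0, φ.rank_pos⟩

/-- The index of the last entry of a row vector of length `r`. -/
def lastIndex : Fin r := ⟨r - 1, Nat.sub_one_lt_of_lt φ.rank_pos⟩

/-- The operator `x ↦ -(A_{j+1}^{(-j)} x^{(1)} + ⋯ + A_r^{(-j)} x^{(r-j)})`, where `j` counts from
`0`. Applied to the coefficients of a solution `H` of `φ_θ H = z H`, these operators give the
entries of the corresponding solution of `g^{(-1)} Φ = g`. -/
def solutionEntry (j : Fin r) (x : Tate Fq s) : Tate Fq s :=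
  -∑ k ∈ Finset.Ici j, twist (-(j : ℤ)) (φ.coeff k) * twist ((k : ℤ) + 1 - j) x

lemma solutionEntry_zero (j : Fin r) : φ.solutionEntry j 0 = 0 := by simp [solutionEntry]

lemma solutionEntry_first (x : Tate Fq s) :
    φ.solutionEntry φ.firstIndex x = theta Fq s * x - φ.phiTheta x := by
  have huniv : Finset.Ici φ.firstIndex = Finset.univ :=
    Finset.eq_univ_of_forall fun k => Finset.mem_Ici.2 (Fin.le_def.2 k.1.zero_le)
  rw [solutionEntry, phiTheta, huniv, sub_add_cancel_left]
  simp [firstIndex, twist]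

lemma solutionEntry_last (x : Tate Fq s) :
    φ.solutionEntry φ.lastIndex x =
      -(twist (1 - (r : ℤ)) (φ.coeff φ.lastIndex) * twist 1 x) := by
  have hlast : ((φ.lastIndex : ℕ) : ℤ) = r - 1 := Nat.cast_pred φ.rank_pos
  have hIci : Finset.Ici φ.lastIndex = {φ.lastIndex} :=
    Finset.eq_singleton_iff_unique_mem.2 ⟨Finset.mem_Ici.2 le_rfl, fun k hk =>
      le_antisymm (Fin.le_def.2 (Nat.le_sub_one_of_lt k.2)) (Finset.mem_Ici.1 hk)⟩
  rw [solutionEntry, hIci, Finset.sum_singleton, add_sub_cancel_left, hlast, neg_sub]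

lemma solutionEntry_succ (x : Tate Fq s) (j : ℕ) (hj : j + 1 < r) :
    φ.solutionEntry ⟨j + 1, hj⟩ x = twist (-1) (φ.solutionEntry ⟨j, by omega⟩ x) +
      twist (-((j : ℤ) + 1)) (φ.coeff ⟨j, by omega⟩) * x := by
  have hIoi : Finset.Ioi (⟨j, by omega⟩ : Fin r) = Finset.Ici ⟨j + 1, hj⟩ := by
    ext k
    simp only [Finset.mem_Ioi, Finset.mem_Ici, Fin.lt_def, Fin.le_def, Nat.succ_le_iff]
  have hterm (k : Fin r) :
      twist (-1) (twist (-(j : ℤ)) (φ.coeff k) * twist ((k : ℤ) + 1 - j) x) =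
        twist (-((j : ℤ) + 1)) (φ.coeff k) * twist ((k : ℤ) + 1 - (j + 1)) x := by
    rw [map_mul, twist_twist, twist_twist]
    ring_nf
  have hself : twist ((j : ℤ) + 1 - (j + 1)) x = x := by simp [twist]
  rw [solutionEntry, solutionEntry, Finset.Ici_eq_cons_Ioi (⟨j, by omega⟩ : Fin r),
    Finset.sum_cons, hIoi, map_neg, map_add, map_sum]
  simp only [hterm, hself, Nat.cast_add, Nat.cast_one]
  ring

lemma hasFDerivAt_solutionEntry_zero (j : Fin r) :
    HasFDerivAt (φ.solutionEntry j) (0 : Tate Fq s →L[KInfty Fq] Tate Fq s) 0 := by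
  have hterm (k : Fin r) (hk : k ∈ Finset.Ici j) : HasFDerivAt
      (fun x => twist (-(j : ℤ)) (φ.coeff k) * twist ((k : ℤ) + 1 - j) x)
      (0 : Tate Fq s →L[KInfty Fq] Tate Fq s) 0 := by
    have hjk : j ≤ k := Finset.mem_Ici.1 hk
    simpa using (hasFDerivAt_twist_zero (Fq := Fq) (s := s) (by omega)).const_mul _
  exact (HasFDerivAt.fun_sum hterm).fun_neg.congr_fderiv (by simp)

lemma hasFDerivAt_phiThetaHom_zero : HasFDerivAt φ.phiThetaHom
    (KInfty.theta Fq • ContinuousLinearMap.id (KInfty Fq) (Tate Fq s)) 0 := by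
  have hφ (x : Tate Fq s) :
      φ.phiThetaHom x = KInfty.theta Fq • x - φ.solutionEntry φ.firstIndex x := by
    rw [solutionEntry_first, theta_smul, sub_sub_cancel, phiThetaHom_apply]
  rw [funext hφ]
  simpa using ((hasFDerivAt_id (0 : Tate Fq s)).const_smul (KInfty.theta Fq)).fun_sub
    (φ.hasFDerivAt_solutionEntry_zero φ.firstIndex)

end DrinfeldModule

namespace DrinfeldModule

variable {Fq : Type*} [Field Fq] [Fintype Fq] {s r : ℕ} (φ : DrinfeldModule Fq s r)

open Tate

lemma coeff_invTwist (n : ℕ) (f : PowerSeries (Tate Fq s)) :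
    PowerSeries.coeff n (invTwist f) = twist (-1) (PowerSeries.coeff n f) :=
  PowerSeries.coeff_map _ n f

lemma invTwist_injective : Function.Injective (invTwist (Fq := Fq) (s := s)) :=
  PowerSeries.map_injective _ (twist (-1)).injective

/-- The element `1 / A_r^{(-r)}` of `𝕋_s`. -/
def leadingInvTwist : Tate Fq s := twist (-(r : ℤ)) ↑φ.leadingUnit⁻¹

lemma leadingInvTwist_mul : φ.leadingInvTwist * twist (-(r : ℤ)) (φ.coeff φ.lastIndex) = 1 := by
  have hinv : (↑φ.leadingUnit⁻¹ : Tate Fq s) * φ.coeff φ.lastIndex = 1 := φ.leadingUnit.inv_mul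
  rw [leadingInvTwist, ← map_mul, hinv, map_one]

/-- The series `-x_r / A_r^{(-r)}` through which the last entry of a row vector `x` enters `x Φ`. -/
def lastQuotient (x : Fin r → PowerSeries (Tate Fq s)) : PowerSeries (Tate Fq s) :=
  -(PowerSeries.C φ.leadingInvTwist * x φ.lastIndex)

lemma vecMul_PhiSeries_first (x : Fin r → PowerSeries (Tate Fq s)) :
    Matrix.vecMul x φ.PhiSeries φ.firstIndex =
      (PowerSeries.C (theta Fq s) - PowerSeries.X) * φ.lastQuotient x := by
  rw [Matrix.vecMul, dotProduct, Finset.sum_eq_single_of_mem φ.lastIndex (Finset.mem_univ _)]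
  · have hlast : ¬ (r - 1 + 1 < r) := by omega
    have hentry : φ.PhiSeries φ.lastIndex φ.firstIndex = PowerSeries.C φ.leadingInvTwist *
        (PowerSeries.X - PowerSeries.C (theta Fq s)) := by
      simp [PhiSeries, Phi, lastIndex, firstIndex, hlast, leadingInvTwist]
    rw [hentry, lastQuotient]
    ring
  · intro i _ hi
    have hlt : (i : ℕ) + 1 < r := by
      have hne : (i : ℕ) ≠ r - 1 := Fin.val_ne_of_ne hi
      omega
    simp [PhiSeries, Phi, firstIndex, hlt]

lemma vecMul_PhiSeries_succ (x : Fin r → PowerSeries (Tate Fq s)) (j : ℕ) (hj : j + 1 < r) :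
    Matrix.vecMul x φ.PhiSeries ⟨j + 1, hj⟩ = x ⟨j, by omega⟩ +
      PowerSeries.C (twist (-((j : ℤ) + 1)) (φ.coeff ⟨j, by omega⟩)) * φ.lastQuotient x := by
  have hne : (⟨j, by omega⟩ : Fin r) ≠ φ.lastIndex := Fin.ne_of_val_ne (by
    change j ≠ r - 1
    omega)
  rw [Matrix.vecMul, dotProduct, Finset.sum_eq_add_of_mem _ _ (Finset.mem_univ _)
    (Finset.mem_univ _) hne]
  · have hlast : ¬ (r - 1 + 1 < r) := by omega
    have hentry : φ.PhiSeries φ.lastIndex ⟨j + 1, hj⟩ = -PowerSeries.C (φ.leadingInvTwist *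
        twist (-((j : ℤ) + 1)) (φ.coeff ⟨j, by omega⟩)) := by
      simp [PhiSeries, Phi, lastIndex, hlast, leadingInvTwist]
    have hone : φ.PhiSeries ⟨j, by omega⟩ ⟨j + 1, hj⟩ = 1 := by simp [PhiSeries, Phi, hj]
    rw [hentry, hone, lastQuotient, map_mul]
    ring
  · rintro i - ⟨hij, hi⟩
    have hne' : j ≠ i := fun h => hij (Fin.ext h.symm)
    have hlt : (i : ℕ) + 1 < r := by
      have hval : (i : ℕ) ≠ r - 1 := Fin.val_ne_of_ne hi
      omega
    simp [PhiSeries, Phi, hlt, hne']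

/-- The row vector over `𝕋_s[[z]]` with last quotient `∑ h_n z ^ n` that the entries `2, …, r` of
the equation `g^{(-1)} Φ = g` determine. -/
def solution (h : ℕ → Tate Fq s) (j : Fin r) : PowerSeries (Tate Fq s) :=
  PowerSeries.mk fun n => φ.solutionEntry j (h n)

lemma solution_first (h : ℕ → Tate Fq s) : φ.solution h φ.firstIndex =
    PowerSeries.mk fun n => theta Fq s * h n - φ.phiTheta (h n) := by
  simp only [solution, solutionEntry_first]

lemma solution_first_eq_iff {h : ℕ → Tate Fq s} :
    φ.solution h φ.firstIndex =
        (PowerSeries.C (theta Fq s) - PowerSeries.X) * PowerSeries.mk h ↔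
      IsDivisionTower φ.phiThetaHom h := by
  have hzero : PowerSeries.coeff 0 ((PowerSeries.C (theta Fq s) - PowerSeries.X) *
      PowerSeries.mk h) = theta Fq s * h 0 := by
    simp [sub_mul]
  have hsucc (n : ℕ) : PowerSeries.coeff (n + 1) ((PowerSeries.C (theta Fq s) - PowerSeries.X) *
      PowerSeries.mk h) = theta Fq s * h (n + 1) - h n := by
    simp [sub_mul, PowerSeries.coeff_succ_X_mul]
  rw [solution_first, PowerSeries.ext_iff]
  constructor
  · refine fun heq => ⟨?_, fun n => ?_⟩
    · simpa [hzero, phiThetaHom_apply] using heq 0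
    · simpa [hsucc, phiThetaHom_apply] using heq (n + 1)
  · rintro ⟨h₀, hs⟩ (_ | n)
    · rw [hzero, PowerSeries.coeff_mk, ← phiThetaHom_apply, h₀, sub_zero]
    · rw [hsucc, PowerSeries.coeff_mk, ← phiThetaHom_apply, hs]

lemma solution_succ (h : ℕ → Tate Fq s) (j : ℕ) (hj : j + 1 < r) :
    φ.solution h ⟨j + 1, hj⟩ = invTwist (φ.solution h ⟨j, by omega⟩) +
      PowerSeries.C (twist (-((j : ℤ) + 1)) (φ.coeff ⟨j, by omega⟩)) * PowerSeries.mk h := by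
  ext1 n
  simp only [solution, map_add, coeff_invTwist, PowerSeries.coeff_mk, PowerSeries.coeff_C_mul,
    solutionEntry_succ]

lemma solutionEntry_last_eq_iff {x y : Tate Fq s} :
    φ.solutionEntry φ.lastIndex x = y ↔ x = -(φ.leadingInvTwist * twist (-1) y) := by
  have htwist : twist (-1) (φ.solutionEntry φ.lastIndex x) =
      -(twist (-(r : ℤ)) (φ.coeff φ.lastIndex) * x) := by
    have hexp : -1 + (1 - (r : ℤ)) = -r := by ring
    rw [solutionEntry_last, map_neg, map_mul, twist_twist, twist_twist, hexp]
    simp [twist]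
  have hinv := φ.leadingInvTwist_mul
  rw [← (twist (-1)).injective.eq_iff, htwist]
  constructor <;> intro h
  · rw [← h, mul_neg, neg_neg, ← mul_assoc, hinv, one_mul]
  · rw [h, mul_neg, neg_neg, ← mul_assoc, mul_comm (twist _ _), hinv, one_mul]

lemma solution_last_eq_iff {h : ℕ → Tate Fq s} {g : Fin r → PowerSeries (Tate Fq s)} :
    φ.solution h φ.lastIndex = g φ.lastIndex ↔
      PowerSeries.mk h = φ.lastQuotient fun j => invTwist (g j) := by
  simp only [PowerSeries.ext_iff, solution, lastQuotient, map_neg, PowerSeries.coeff_mk,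
    PowerSeries.coeff_C_mul, coeff_invTwist, solutionEntry_last_eq_iff]

lemma vecMul_invTwist_solution {h : ℕ → Tate Fq s} (hh : IsDivisionTower φ.phiThetaHom h) :
    Matrix.vecMul (fun j => invTwist (φ.solution h j)) φ.PhiSeries = φ.solution h := by
  have hmk : PowerSeries.mk h = φ.lastQuotient fun j => invTwist (φ.solution h j) :=
    φ.solution_last_eq_iff.1 rfl
  funext ⟨j, hj⟩
  cases j with
  | zero =>
    exact (φ.vecMul_PhiSeries_first _).trans (hmk ▸ φ.solution_first_eq_iff.2 hh).symm
  | succ j => rw [vecMul_PhiSeries_succ, solution_succ, hmk]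

variable {φ} in
lemma eq_solution_of_vecMul_eq {g : Fin r → PowerSeries (Tate Fq s)} {h : ℕ → Tate Fq s}
    (hg : Matrix.vecMul (fun j => invTwist (g j)) φ.PhiSeries = g)
    (hh : PowerSeries.mk h = φ.lastQuotient fun j => invTwist (g j)) : g = φ.solution h := by
  funext ⟨j, hj⟩
  refine Nat.decreasingInduction' (m := j) (n := r - 1)
    (P := fun j => ∀ hj : j < r, g ⟨j, hj⟩ = φ.solution h ⟨j, hj⟩) ?_ (by omega) ?_ hj
  · intro k hk _ ih hkr
    have hsucc := ih (by omega)
    rw [← congrFun hg, vecMul_PhiSeries_succ, solution_succ, ← hh, add_left_inj] at hsucc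
    exact invTwist_injective hsucc
  · exact fun _ => (φ.solution_last_eq_iff.2 hh).symm

lemma vecMul_invTwist_eq_iff {g : Fin r → PowerSeries (Tate Fq s)} :
    Matrix.vecMul (fun j => invTwist (g j)) φ.PhiSeries = g ↔
      ∃ h, IsDivisionTower φ.phiThetaHom h ∧ g = φ.solution h := by
  constructor
  · intro hg
    let h : ℕ → Tate Fq s := fun n =>
      PowerSeries.coeff n (φ.lastQuotient fun j => invTwist (g j))
    have hmk : PowerSeries.mk h = φ.lastQuotient fun j => invTwist (g j) := by
      ext1 n
      exact PowerSeries.coeff_mk n h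
    have hsol := eq_solution_of_vecMul_eq hg hmk
    refine ⟨h, φ.solution_first_eq_iff.1 ?_, hsol⟩
    rw [← hsol, ← congrFun hg, vecMul_PhiSeries_first, hmk]
  · rintro ⟨h, hh, rfl⟩
    exact φ.vecMul_invTwist_solution hh

lemma solution_mem_tateDisc {h : ℕ → Tate Fq s} {l : Tate Fq s}
    (hlim : Tendsto (fun n => KInfty.theta Fq ^ (n + 1) • h n) atTop (𝓝 l)) (j : Fin r) :
    φ.solution h j ∈ TateDisc (theta Fq s) := by
  refine (TateDisc.mem_iff _ _).2 ?_
  have hentry := tendsto_pow_smul_comp_of_hasFDerivAt_zero (φ.solutionEntry_zero j)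
    (φ.hasFDerivAt_solutionEntry_zero j) KInfty.one_lt_norm_theta hlim
  refine (tendsto_zero_iff_norm_tendsto_zero.1 hentry).congr fun n => ?_
  rw [norm_smul, norm_pow, KInfty.norm_theta, norm_theta, solution, PowerSeries.coeff_mk, mul_comm]

variable {φ} in
lemma tendsto_D0_of_eq_solution {g : Fin r → TateDisc (theta Fq s)} {h : ℕ → Tate Fq s}
    (hh : IsDivisionTower φ.phiThetaHom h) (hg : (fun j => (g j).1) = φ.solution h) :
    Tendsto (fun n => KInfty.theta Fq ^ (n + 1) • h n) atTop (𝓝 (φ.D0 g)) := by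
  have hfirst : (g φ.firstIndex).1 =
      (PowerSeries.C (theta Fq s) - PowerSeries.X) * PowerSeries.mk h :=
    (congrFun hg φ.firstIndex).trans (φ.solution_first_eq_iff.2 hh)
  have hsum := (TateDisc.summable_eval _ (g φ.firstIndex)).hasSum.tendsto_sum_nat
  refine (hsum.comp (tendsto_add_atTop_nat 1)).congr fun n => ?_
  rw [Function.comp_apply, hfirst, sum_range_coeff_C_sub_X_mul_mul_pow, PowerSeries.coeff_mk,
    theta_pow_smul]

lemma mem_V_and_D0_eq_iff {g : Fin r → TateDisc (theta Fq s)} {l : Tate Fq s} :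
    g ∈ φ.V ∧ φ.D0 g = l ↔ l ∈ φ.periodLattice ∧
      (fun j => (g j).1) =
        φ.solution fun n => φ.exp ((KInfty.theta Fq ^ (n + 1))⁻¹ • l) := by
  have htower {h : ℕ → Tate Fq s} := isDivisionTower_and_tendsto_iff (h := h) (l := l)
    φ.hasFDerivAt_phiThetaHom_zero φ.exp_zero φ.hasFDerivAt_exp_zero φ.exp_theta_mul
    KInfty.one_lt_norm_theta
  constructor
  · rintro ⟨hg, rfl⟩
    obtain ⟨h, hh, hsol⟩ := φ.vecMul_invTwist_eq_iff.1 hg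
    obtain ⟨hl, rfl⟩ := htower.1 ⟨hh, tendsto_D0_of_eq_solution hh hsol⟩
    exact ⟨hl, hsol⟩
  · rintro ⟨hl, hsol⟩
    obtain ⟨hh, hlim⟩ := htower.2 ⟨hl, rfl⟩
    exact ⟨φ.vecMul_invTwist_eq_iff.2 ⟨_, hh, hsol⟩,
      tendsto_nhds_unique (tendsto_D0_of_eq_solution hh hsol) hlim⟩

theorem bijOn_D0 : Set.BijOn φ.D0 φ.V (φ.periodLattice : Set (Tate Fq s)) := by
  refine ⟨fun g hg => (φ.mem_V_and_D0_eq_iff.1 ⟨hg, rfl⟩).1, fun f hf g hg hfg => ?_,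
    fun l hl => ?_⟩
  · have hf' := (φ.mem_V_and_D0_eq_iff.1 ⟨hf, hfg⟩).2
    have hg' := (φ.mem_V_and_D0_eq_iff.1 ⟨hg, rfl⟩).2
    exact funext fun j => Subtype.ext (congrFun (hf'.trans hg'.symm) j)
  · have hlim := (tendsto_pow_smul_map_inv_pow_smul φ.exp_zero φ.hasFDerivAt_exp_zero
      KInfty.one_lt_norm_theta l).comp (tendsto_add_atTop_nat 1)
    exact ⟨fun j => ⟨_, φ.solution_mem_tateDisc hlim j⟩, φ.mem_V_and_D0_eq_iff.2 ⟨hl, rfl⟩⟩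

end DrinfeldModule

namespace Tate

variable {Fq : Type*} [Field Fq] [Fintype Fq] {s : ℕ}

lemma twist_neg_one_eq_self_iff {f : Tate Fq s} :
    twist (-1) f = f ↔ ∀ ν, coeff ν f ∈ Set.range (algebraMap Fq (CInfty Fq)) := by
  have htwist : twist ((1 : ℕ) : ℤ) (twist (-1) f) = f := by
    rw [twist_twist]
    simp [twist]
  rw [← (twist (Fq := Fq) (s := s) ((1 : ℕ) : ℤ)).injective.eq_iff, htwist, eq_comm, Tate.ext_iff]
  simp only [coeff_twist, pow_one, mem_range_algebraMap_iff_pow_card_eq]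

lemma coeff_mul_X (f : Tate Fq s) (i : Fin s) (ν : Fin s →₀ ℕ) :
    coeff ν (f * X i) = if i ∈ ν.support then coeff (ν - Finsupp.single i 1) f else 0 := by
  classical
  refine (MvPowerSeries.coeff_mul_monomial (R := CInfty Fq) ν (Finsupp.single i 1) f.1 1).trans ?_
  simp only [Finsupp.single_le_iff, Nat.one_le_iff_ne_zero, Finsupp.mem_support_iff, mul_one]
  rfl

end Tate

namespace TateDisc

variable {Fq : Type*} [Field Fq] [Fintype Fq] {s : ℕ} (c : Tate Fq s)

lemma eval_add (f g : TateDisc c) : eval c (f + g) = eval c f + eval c g := by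
  simp only [eval, Subring.coe_add, map_add, add_mul]
  exact (summable_eval c f).tsum_add (summable_eval c g)

lemma eval_mul (f g : TateDisc c) : eval c (f * g) = eval c f * eval c g :=
  tsum_coeff_mul_mul_pow (summable_eval c f) (summable_eval c g)

/-- The constant series in `𝕋_s{z/c}`. -/
def const : Tate Fq s →+* TateDisc c :=
  PowerSeries.C.codRestrict _ fun a => PowerSeries.isRestricted_C _ a

/-- The variable `z` of `𝕋_s{z/c}`. -/
def var : TateDisc c := ⟨PowerSeries.X, PowerSeries.isRestricted_monomial _ 1 1⟩

lemma coe_const (a : Tate Fq s) : (const c a).1 = PowerSeries.C a := rfl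

lemma coe_var : (var c).1 = PowerSeries.X := rfl

lemma eval_const (a : Tate Fq s) : eval c (const c a) = a := by
  rw [eval, tsum_eq_single 0 fun n hn => by simp [coe_const, PowerSeries.coeff_C, hn]]
  simp [coe_const]

lemma eval_var : eval c (var c) = c := by
  rw [eval, tsum_eq_single 1 fun n hn => by simp [coe_var, PowerSeries.coeff_X, hn]]
  simp [coe_var]

/-- Evaluation at `z = c` as a ring homomorphism. -/
def evalHom : TateDisc c →+* Tate Fq s where
  toFun := eval c
  map_one' := by rw [← map_one (const c), eval_const]
  map_zero' := by rw [← map_zero (const c), eval_const]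
  map_mul' := eval_mul c
  map_add' := eval_add c

/-- The map `A[t_s] → 𝕋_s{z/c}` that sends `θ` to `z` and `t_i` to `t_i`. -/
def ofPoly : MvPolynomial (Fin s) (Polynomial Fq) →+* TateDisc c :=
  MvPolynomial.eval₂Hom (Polynomial.eval₂RingHom
    ((const c).comp ((Tate.C Fq s).comp (algebraMap Fq (CInfty Fq)))) (var c))
    fun i => const c (Tate.X i)

/-- `𝕋_s{z/c}` as an `A[t_s]`-algebra in which `θ` acts as `z`, so that evaluation at `z = θ`
is linear. -/
instance : Algebra (MvPolynomial (Fin s) (Polynomial Fq)) (TateDisc c) := (ofPoly c).toAlgebra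

lemma eval_ofPoly (p : MvPolynomial (Fin s) (Polynomial Fq)) :
    eval (Tate.theta Fq s) (ofPoly (Tate.theta Fq s) p) = Tate.ofPoly Fq s p := by
  have hcomp : (evalHom (Tate.theta Fq s)).comp (ofPoly (Tate.theta Fq s)) =
      Tate.ofPoly Fq s := by
    refine MvPolynomial.ringHom_ext' (Polynomial.ringHom_ext' ?_ ?_) fun i => ?_
    · ext b : 1
      simpa [ofPoly, Tate.ofPoly] using! eval_const _ _
    · simpa [ofPoly, Tate.ofPoly] using! eval_var _
    · simpa [ofPoly, Tate.ofPoly] using! eval_const _ _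
  exact RingHom.congr_fun hcomp p

variable (Fq s) in
/-- Evaluation at `z = θ` as a homomorphism of `A[t_s]`-algebras. -/
def evalAlgHom :
    TateDisc (Tate.theta Fq s) →ₐ[MvPolynomial (Fin s) (Polynomial Fq)] Tate Fq s where
  __ := evalHom (Tate.theta Fq s)
  commutes' := eval_ofPoly

lemma ofPoly_C (p : Polynomial Fq) : (ofPoly c (MvPolynomial.C p)).1 =
    PowerSeries.map ((Tate.C Fq s).comp (algebraMap Fq (CInfty Fq))) p := by
  have hcomp : (TateDisc c).subtype.comp ((ofPoly c).comp MvPolynomial.C) =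
      (PowerSeries.map ((Tate.C Fq s).comp (algebraMap Fq (CInfty Fq)))).comp
        Polynomial.coeToPowerSeries.ringHom := by
    refine Polynomial.ringHom_ext' ?_ ?_
    · ext b : 1
      simp [ofPoly, coe_const]
    · simp [ofPoly, coe_var]
  exact RingHom.congr_fun hcomp p

lemma coeff_ofPoly (p : MvPolynomial (Fin s) (Polynomial Fq)) (n : ℕ) (ν : Fin s →₀ ℕ) :
    Tate.coeff ν (PowerSeries.coeff n (ofPoly c p).1) =
      algebraMap Fq (CInfty Fq) ((p.coeff ν).coeff n) := by
  classical
  induction p using MvPolynomial.induction_on generalizing ν with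
  | C p =>
    rw [ofPoly_C, PowerSeries.coeff_map, Polynomial.coeff_coe, RingHom.comp_apply, Tate.coeff_C,
      MvPolynomial.coeff_C, apply_ite (Polynomial.coeff · n), Polynomial.coeff_zero,
      apply_ite (algebraMap Fq (CInfty Fq)), map_zero]
    simp only [eq_comm]
  | add p₁ p₂ h₁ h₂ =>
    rw [map_add, Subring.coe_add, map_add, Tate.coeff_add, h₁, h₂,
      MvPolynomial.coeff_add, Polynomial.coeff_add, map_add]
  | mul_X p i h =>
    have hmul : (ofPoly c (p * MvPolynomial.X i)).1 =
        (ofPoly c p).1 * PowerSeries.C (Tate.X i) := by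
      simp [ofPoly, coe_const]
    rw [hmul, PowerSeries.coeff_mul_C, Tate.coeff_mul_X, MvPolynomial.coeff_mul_X']
    split_ifs with hi
    · exact h _
    · simp

lemma ofPoly_injective : Function.Injective (ofPoly c) := by
  intro p p' h
  ext ν n
  apply (algebraMap Fq (CInfty Fq)).injective
  rw [← coeff_ofPoly c, h, coeff_ofPoly]

variable {c}

lemma finite_setOf_le_norm_coeff_coeff (hc : 1 ≤ ‖c‖) (f : TateDisc c) {ε : ℝ} (hε : 0 < ε) :
    {p : ℕ × (Fin s →₀ ℕ) | ε ≤ ‖Tate.coeff p.2 (PowerSeries.coeff p.1 f.1)‖}.Finite := by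
  obtain ⟨N, hN⟩ := eventually_atTop.1 (((mem_iff c f.1).1 f.2).eventually_lt_const hε)
  have hfin (n : ℕ) : {ν | ε ≤ ‖Tate.coeff ν (PowerSeries.coeff n f.1)‖}.Finite := by
    simpa only [eventually_cofinite, not_lt] using
      (Tate.tendsto_coeff (PowerSeries.coeff n f.1)).eventually_lt_const hε
  refine ((Set.finite_Iio N).biUnion fun n _ => (Set.finite_singleton n).prod (hfin n)).subset ?_
  rintro ⟨n, ν⟩ hle
  refine Set.mem_biUnion (x := n) ?_ ⟨rfl, hle⟩
  by_contra hn
  refine (hN n (not_lt.1 hn)).not_ge ?_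
  calc ε ≤ ‖PowerSeries.coeff n f.1‖ := le_trans hle (Tate.coeff_le_norm _ ν)
    _ ≤ ‖PowerSeries.coeff n f.1‖ * ‖c‖ ^ n :=
      le_mul_of_one_le_right (norm_nonneg _) (one_le_pow₀ hc)

lemma invTwist_eq_self_iff_forall_coeff {f : PowerSeries (Tate Fq s)} :
    DrinfeldModule.invTwist f = f ↔ ∀ n ν,
      Tate.coeff ν (PowerSeries.coeff n f) ∈ Set.range (algebraMap Fq (CInfty Fq)) := by
  simp only [PowerSeries.ext_iff, DrinfeldModule.coeff_invTwist, Tate.twist_neg_one_eq_self_iff]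

lemma invTwist_eq_self_iff (hc : 1 ≤ ‖c‖) {f : TateDisc c} :
    DrinfeldModule.invTwist f.1 = f.1 ↔ f ∈ Set.range (ofPoly c) := by
  rw [invTwist_eq_self_iff_forall_coeff]
  constructor
  · intro hf
    choose b hb using hf
    have hsupp : (fun i : ℕ × (Fin s →₀ ℕ) => b i.1 i.2).support.Finite := by
      refine (finite_setOf_le_norm_coeff_coeff hc f one_pos).subset fun i hi => ?_
      rw [Set.mem_ofPred_eq, ← hb]
      refine one_le_norm_of_pow_eq_self Fintype.one_lt_card
        (mem_range_algebraMap_iff_pow_card_eq.1 ⟨b i.1 i.2, rfl⟩) ?_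
      rwa [Ne, map_eq_zero]
    obtain ⟨p, hp⟩ := exists_mvPolynomial_coeff_coeff_eq hsupp
    refine ⟨p, Subtype.ext (PowerSeries.ext fun n => Tate.ext fun ν => ?_)⟩
    rw [coeff_ofPoly, hp, hb]
  · rintro ⟨p, rfl⟩ n ν
    exact ⟨_, (coeff_ofPoly c p n ν).symm⟩

end TateDisc

namespace DrinfeldModule

variable {Fq : Type*} [Field Fq] [Fintype Fq] {s r : ℕ} {φ : DrinfeldModule Fq s r}
  {Ψ : Matrix.GeneralLinearGroup (Fin r) (TateDisc (Tate.theta Fq s))}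

lemma IsRigidAnalyticTrivialization.mem_V_iff (hΨ : φ.IsRigidAnalyticTrivialization Ψ)
    (g : Fin r → TateDisc (Tate.theta Fq s)) :
    g ∈ φ.V ↔ ∀ j, Matrix.vecMul g Ψ.val j ∈ Set.range (TateDisc.ofPoly (Tate.theta Fq s)) := by
  have hθ : 1 ≤ ‖Tate.theta Fq s‖ := by
    rw [Tate.norm_theta]
    exact_mod_cast Fintype.card_pos (α := Fq)
  simp only [← TateDisc.invTwist_eq_self_iff hθ]
  let ι := (TateDisc (Tate.theta Fq s)).subtype
  let T := (PowerSeries.map (Tate.twist (-1) : Tate Fq s ≃+* Tate Fq s).toRingHom).comp ι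
  exact vecMul_map_eq_iff_of_isUnit (ι := ι) (T := T) Ψ.isUnit hΨ g

variable (Ψ) in
/-- The linear map `c ↦ c Ψ⁻¹` on row vectors over `A[t_s]`, whose entries are read in
`𝕋_s{z/θ}` with `z` in place of `θ`. -/
def sectionMap : (Fin r → MvPolynomial (Fin s) (Polynomial Fq))
    →ₗ[MvPolynomial (Fin s) (Polynomial Fq)] (Fin r → TateDisc (Tate.theta Fq s)) :=
  (Matrix.vecMulLinear (Ψ⁻¹).val).restrictScalars _ ∘ₗ (Algebra.linearMap _ _).compLeft (Fin r)

lemma sectionMap_eq_iff {c : Fin r → MvPolynomial (Fin s) (Polynomial Fq)}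
    {g : Fin r → TateDisc (Tate.theta Fq s)} :
    sectionMap Ψ c = g ↔ (fun j => TateDisc.ofPoly (Tate.theta Fq s) (c j)) =
      Matrix.vecMul g Ψ.val := by
  change Matrix.vecMul (fun j => TateDisc.ofPoly (Tate.theta Fq s) (c j)) (Ψ⁻¹).val = g ↔ _
  constructor
  · rintro rfl
    rw [Matrix.vecMul_vecMul, Units.inv_mul, Matrix.vecMul_one]
  · intro h
    rw [h, Matrix.vecMul_vecMul, Units.mul_inv, Matrix.vecMul_one]

lemma IsRigidAnalyticTrivialization.bijOn_sectionMap (hΨ : φ.IsRigidAnalyticTrivialization Ψ) :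
    Set.BijOn (sectionMap Ψ) Set.univ φ.V := by
  refine ⟨fun c _ => ?_, fun c _ d _ hcd => ?_, fun g hg => ?_⟩
  · rw [hΨ.mem_V_iff, ← sectionMap_eq_iff.1 rfl]
    exact fun j => ⟨c j, rfl⟩
  · have hofPoly := (sectionMap_eq_iff.1 hcd).trans (sectionMap_eq_iff.1 rfl).symm
    exact funext fun j => TateDisc.ofPoly_injective _ (congrFun hofPoly j)
  · choose c hc using (hΨ.mem_V_iff g).1 hg
    exact ⟨c, Set.mem_univ c, sectionMap_eq_iff.2 (funext hc)⟩

variable (φ) in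
/-- `D_0` as a linear map over `A[t_s]`, which acts on `𝕋_s{z/θ}` with `z` in place of `θ`. -/
def D0Linear : (Fin r → TateDisc (Tate.theta Fq s))
    →ₗ[MvPolynomial (Fin s) (Polynomial Fq)] Tate Fq s :=
  (TateDisc.evalAlgHom Fq s).toLinearMap ∘ₗ LinearMap.proj φ.firstIndex

lemma coe_D0Linear : ⇑φ.D0Linear = φ.D0 := rfl

/-- The isomorphism `c ↦ D_0 (c Ψ⁻¹)` between the row vectors over `A[t_s]` and the period
lattice. -/
def IsRigidAnalyticTrivialization.periodEquiv (hΨ : φ.IsRigidAnalyticTrivialization Ψ) :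
    (Fin r → MvPolynomial (Fin s) (Polynomial Fq))
      ≃ₗ[MvPolynomial (Fin s) (Polynomial Fq)] φ.periodLattice :=
  have hbij : Set.BijOn (φ.D0Linear ∘ₗ sectionMap Ψ) Set.univ
      (φ.periodLattice : Set (Tate Fq s)) := by
    rw [LinearMap.coe_comp, coe_D0Linear]
    exact φ.bijOn_D0.comp hΨ.bijOn_sectionMap
  have hrange : LinearMap.range (φ.D0Linear ∘ₗ sectionMap Ψ) = φ.periodLattice :=
    SetLike.coe_injective (Set.image_univ.symm.trans hbij.image_eq)
  (LinearEquiv.ofInjective _ (Set.injOn_univ.1 hbij.injOn)).trans (LinearEquiv.ofEq _ _ hrange)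

end DrinfeldModule

end

end TateDrinfeld

theorem theorem4_general {Fq : Type*} [Field Fq] [Fintype Fq] {s r : ℕ}
    (φ : DrinfeldModule Fq s r) :
    Set.BijOn φ.D0 φ.V (φ.periodLattice : Set (Tate Fq s)) ∧
      ∀ Ψ : Matrix.GeneralLinearGroup (Fin r) (TateDisc (Tate.theta Fq s)),
        φ.IsRigidAnalyticTrivialization Ψ →
          Module.Free (MvPolynomial (Fin s) (Polynomial Fq)) φ.periodLattice ∧
          Module.Finite (MvPolynomial (Fin s) (Polynomial Fq)) φ.periodLattice ∧
          Module.finrank (MvPolynomial (Fin s) (Polynomial Fq)) φ.periodLattice = r := by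
  refine ⟨φ.bijOn_D0, fun Ψ hΨ => ?_⟩
  refine ⟨Module.Free.of_equiv hΨ.periodEquiv, Module.Finite.equiv hΨ.periodEquiv, ?_⟩
  rw [← hΨ.periodEquiv.finrank_eq, Module.finrank_fin_fun]

theorem theorem4 {Fq : Type*} [Field Fq] [Fintype Fq] {s r : ℕ} (φ : DrinfeldModule Fq s r)
    (Ψ : Matrix.GeneralLinearGroup (Fin r) (TateDisc (Tate.theta Fq s)))
    (hΨ : φ.IsRigidAnalyticTrivialization Ψ) :
    Set.BijOn φ.D0 φ.V (φ.periodLattice : Set (Tate Fq s)) ∧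
      Module.Free (MvPolynomial (Fin s) (Polynomial Fq)) φ.periodLattice ∧
      Module.Finite (MvPolynomial (Fin s) (Polynomial Fq)) φ.periodLattice ∧
      Module.finrank (MvPolynomial (Fin s) (Polynomial Fq)) φ.periodLattice = r :=
  ⟨(theorem4_general φ).1, (theorem4_general φ).2 Ψ hΨ⟩
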